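/- Let $M$ be a smooth manifold of dimension $2n+1$ with a contact form $\eta$, i.e. a smooth $1$-form such that $\eta\wedge(\mathrm d\eta)^n$ vanishes nowhere. Let $\mathcal R$ be its Reeb vector field ($\iota_{\mathcal R}\mathrm d\eta=0$, $\eta(\mathcal R)=1$), and let $\flat:TM\to T^*M$ be the vector bundle isomorphism $\flat(v)=\iota_v\mathrm d\eta+\eta(v)\eta$. For $f,g\in C^\infty(M)$ define the Hamiltonian vector field $X_f$ by $\flat(X_f)=\mathrm df-(\mathcal R(f)+f)\,\eta$ and the Jacobi bracket by $$\{f,g\}=-\mathrm d\eta\big(\flat^{-1}(\mathrm df),\flat^{-1}(\mathrm dg)\big)-f\,\mathcal R(g)+g\,\mathcal R(f).$$ Let $H\in C^\infty(M)$. A smooth vector field $X$ on $M$ is a dynamical symmetry of $(M,\eta,H)$ if $\eta([X_H,X])=0$, and a function $f\in C^\infty(M)$ is dissipated if $\{H,f\}=0$. Let $G$ be a Lie group with Lie algebra $\mathfrak g$ acting smoothly on $M$ by maps $\Phi_g(x)=g\cdot x$ such that $\Phi_g^*\eta=\eta$ and $H\circ\Phi_g=H$ for all $g\in G$. For $\xi\in\mathfrak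 g$ let $\xi_M(x)=\frac{\mathrm d}{\mathrm dt}\big|_{t=0}\exp(t\xi)\cdot x$ be the infinitesimal generator, let $J:M\to\mathfrak g^*$, $J(x)(\xi)=-\eta_x(\xi_M(x))$, be the momentum map, and put $\hat J(\xi)(x)=J(x)(\xi)$. Then, for every $\xi\in\mathfrak g$, the vector field $\xi_M$ is a dynamical symmetry of $(M,\eta,H)$, and $\hat J(\xi)=-\eta(\xi_M)$ is a dissipated function. -/

import Mathlib

open scoped Manifold ContDiff
namespace ContactGeometry
noncomputable section

section LinearAlgebra
variable {V : Type*} [AddCommGroup V] [Module ℝ V]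

/-- The function
`(v₀, …, v₂ₙ) ↦ α(v₀) θ(v₁, v₂) θ(v₃, v₄) ⋯ θ(v₂ₙ₋₁, v₂ₙ)`. -/
def contactProd (α : V →ₗ[ℝ] ℝ) (θ : V [⋀^Fin 2]→ₗ[ℝ] ℝ) (n : ℕ)
    (v : Fin (2 * n + 1) → V) : ℝ :=
  α (v 0) * ∏ i : Fin n, θ ![v ⟨2 * i + 1, by omega⟩, v ⟨2 * i + 2, by omega⟩]

theorem contactProd_update (α : V →ₗ[ℝ] ℝ) (θ : V [⋀^Fin 2]→ₗ[ℝ] ℝ) (n : ℕ)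
    (v : Fin (2 * n + 1) → V) (j : Fin (2 * n + 1)) :
    ∃ L : V →ₗ[ℝ] ℝ, ∀ x, contactProd α θ n (Function.update v j x) = L x := by
  obtain ⟨j, hj⟩ := j
  have key (a b : V) : (∃ L : V →ₗ[ℝ] ℝ, ∀ x, θ ![x, b] = L x) ∧
      ∃ L : V →ₗ[ℝ] ℝ, ∀ x, θ ![a, x] = L x :=
    ⟨⟨θ.toMultilinearMap.toLinearMap ![0, b] 0, fun x =>
        congrArg θ (by ext i; fin_cases i <;> rfl)⟩,
      ⟨θ.toMultilinearMap.toLinearMap ![a, 0] 1, fun x =>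
        congrArg θ (by ext i; fin_cases i <;> rfl)⟩⟩
  rcases Nat.eq_zero_or_pos j with rfl | hpos
  · refine ⟨(∏ i : Fin n, θ ![v ⟨2 * i + 1, by omega⟩, v ⟨2 * i + 2, by omega⟩]) • α,
      fun x => ?_⟩
    have h0 : (⟨0, hj⟩ : Fin (2 * n + 1)) = 0 := rfl
    simp [contactProd, Function.update, h0, Fin.ext_iff, mul_comm]
  · obtain ⟨i₀, hi₀⟩ : ∃ i₀ : Fin n, j = 2 * i₀ + 1 ∨ j = 2 * i₀ + 2 :=
      ⟨⟨(j - 1) / 2, by omega⟩, by simp only; omega⟩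
    have hprod (x : V) : contactProd α θ n (Function.update v ⟨j, hj⟩ x) =
        α (v 0) * ((∏ i ∈ Finset.univ.erase i₀,
          θ ![v ⟨2 * i + 1, by omega⟩, v ⟨2 * i + 2, by omega⟩]) *
        θ ![Function.update v ⟨j, hj⟩ x ⟨2 * i₀ + 1, by omega⟩,
          Function.update v ⟨j, hj⟩ x ⟨2 * i₀ + 2, by omega⟩]) := by
      unfold contactProd
      rw [← Finset.prod_erase_mul _ _ (Finset.mem_univ i₀)]
      congr 1
      · rw [Function.update_of_ne]
        intro h
        have := congrArg Fin.val h
        simp at this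
        omega
      · congr 1
        refine Finset.prod_congr rfl fun i hi => ?_
        have hne : (i : ℕ) ≠ i₀ := fun h => (Finset.ne_of_mem_erase hi) (Fin.ext h)
        rw [Function.update_of_ne, Function.update_of_ne] <;>
        · intro h
          have := congrArg Fin.val h
          simp only at this
          omega
    rcases hi₀ with rfl | rfl
    · obtain ⟨L, hL⟩ := (key 0 (v ⟨2 * i₀ + 2, by omega⟩)).1
      refine ⟨(α (v 0) * (∏ i ∈ Finset.univ.erase i₀,
          θ ![v ⟨2 * i + 1, by omega⟩, v ⟨2 * i + 2, by omega⟩])) • L, fun x => ?_⟩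
      rw [hprod, Function.update_self, Function.update_of_ne (by simp [Fin.ext_iff]), hL]
      simp [mul_assoc]
    · obtain ⟨L, hL⟩ := (key (v ⟨2 * i₀ + 1, by omega⟩) 0).2
      refine ⟨(α (v 0) * (∏ i ∈ Finset.univ.erase i₀,
          θ ![v ⟨2 * i + 1, by omega⟩, v ⟨2 * i + 2, by omega⟩])) • L, fun x => ?_⟩
      rw [hprod, Function.update_self, Function.update_of_ne (by simp [Fin.ext_iff]), hL]
      simp [mul_assoc]

/-- `contactProd` as a multilinear map, that is, `α ⊗ θ ⊗ ⋯ ⊗ θ`. -/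
def contactTensor (α : V →ₗ[ℝ] ℝ) (θ : V [⋀^Fin 2]→ₗ[ℝ] ℝ) (n : ℕ) :
    MultilinearMap ℝ (fun _ : Fin (2 * n + 1) => V) ℝ :=
  MultilinearMap.mk' (contactProd α θ n)
    (fun v j x y => by
      obtain ⟨L, hL⟩ := contactProd_update α θ n v j
      rw [hL, hL, hL, map_add])
    (fun v j c x => by
      obtain ⟨L, hL⟩ := contactProd_update α θ n v j
      rw [hL, hL, map_smul])

/-- The alternating form `α ∧ θⁿ`, with `β ∧ γ = (1 / (k! l!)) Alt (β ⊗ γ)` for a `k`-form `β`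
and an `l`-form `γ`, where `Alt` is the signed sum over all permutations. -/
def wedgePow (α : V →ₗ[ℝ] ℝ) (θ : V [⋀^Fin 2]→ₗ[ℝ] ℝ) (n : ℕ) :
    V [⋀^Fin (2 * n + 1)]→ₗ[ℝ] ℝ :=
  ((2 : ℝ) ^ n)⁻¹ • MultilinearMap.alternatization (contactTensor α θ n)

/-- The linear form `ι_v θ = θ(v, ·)`. -/
def contract (θ : V [⋀^Fin 2]→ₗ[ℝ] ℝ) (v : V) : Module.Dual ℝ V :=
  θ.toMultilinearMap.toLinearMap ![v, 0] 1

theorem contract_apply (θ : V [⋀^Fin 2]→ₗ[ℝ] ℝ) (v w : V) : contract θ v w = θ ![v, w] :=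
  congrArg θ (by ext i; fin_cases i <;> rfl)

theorem contract_antisymm (θ : V [⋀^Fin 2]→ₗ[ℝ] ℝ) (v w : V) :
    contract θ v w = - contract θ w v := by
  rw [contract_apply, contract_apply]
  have h := θ.map_swap ![w, v] (i := 0) (j := 1) (by decide)
  rw [← h]
  congr 1
  ext i
  fin_cases i <;> simp

theorem contract_self (θ : V [⋀^Fin 2]→ₗ[ℝ] ℝ) (v : V) : contract θ v v = 0 := by
  have := contract_antisymm θ v v
  linarith

/-- The linear map `v ↦ ι_v θ + α(v) α`. -/
def flatLin (α : Module.Dual ℝ V) (θ : V [⋀^Fin 2]→ₗ[ℝ] ℝ) : V →ₗ[ℝ] Module.Dual ℝ V where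
  toFun v := contract θ v + α v • α
  map_add' v w := by
    ext x
    simp only [LinearMap.add_apply, contract_antisymm θ _ x, map_add, LinearMap.smul_apply,
      smul_eq_mul]
    ring
  map_smul' c v := by
    ext x
    simp only [LinearMap.add_apply, contract_antisymm θ _ x, map_smul, LinearMap.smul_apply,
      smul_eq_mul, RingHom.id_apply]
    ring

theorem flatLin_injective [FiniteDimensional ℝ V] {n : ℕ} (hV : Module.finrank ℝ V = 2 * n + 1)
    {α : Module.Dual ℝ V} {θ : V [⋀^Fin 2]→ₗ[ℝ] ℝ} (h : wedgePow α θ n ≠ 0) :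
    Function.Injective (flatLin α θ) := by
  rw [injective_iff_map_eq_zero]
  intro v hv
  by_contra hv0
  have hαv : α v = 0 := by
    have := LinearMap.congr_fun hv v
    simpa [flatLin, contract_self] using this
  have hθv (w : V) : θ ![v, w] = 0 := by
    have := LinearMap.congr_fun hv w
    simpa [flatLin, contract_apply, hαv] using this
  have hθv' (w : V) : θ ![w, v] = 0 := by
    rw [← contract_apply, contract_antisymm, contract_apply, hθv, neg_zero]
  -- a basis whose first vector is `v`
  apply h
  obtain ⟨b, i₁, hb⟩ : ∃ (b : Module.Basis (Fin (2 * n + 1)) ℝ V) (i : _), b i = v := by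
    have hli : LinearIndepOn ℝ id ({v} : Set V) := by
      rw [linearIndepOn_singleton_iff]
      simpa using hv0
    let B := Module.Basis.extend hli
    have hmem : v ∈ hli.extend (Set.subset_univ _) := hli.subset_extend _ rfl
    let e := (Module.finBasisOfFinrankEq ℝ V hV).indexEquiv B
    exact ⟨B.reindex e.symm, e.symm ⟨v, hmem⟩, by simp [B]⟩
  refine Module.Basis.ext_alternating b fun w hw => ?_
  obtain ⟨p, hp⟩ : ∃ p, w p = i₁ := (Finite.surjective_of_injective hw) i₁
  simp only [wedgePow, AlternatingMap.smul_apply, MultilinearMap.alternatization_apply,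
    AlternatingMap.zero_apply]
  rw [Finset.sum_eq_zero, smul_zero]
  intro σ _
  rw [MultilinearMap.domDomCongr_apply]
  have : contactProd α θ n (fun i => b (w (σ i))) = 0 := by
    obtain ⟨⟨j, hj⟩, hjp⟩ := σ.surjective p
    have hval : b (w (σ ⟨j, hj⟩)) = v := by rw [hjp, hp, hb]
    unfold contactProd
    rcases Nat.eq_zero_or_pos j with rfl | hpos
    · have h0 : (⟨0, hj⟩ : Fin (2 * n + 1)) = 0 := rfl
      rw [h0] at hval
      simp only [hval, hαv, zero_mul]
    · obtain ⟨i₀, hi₀⟩ : ∃ i₀ : Fin n, j = 2 * i₀ + 1 ∨ j = 2 * i₀ + 2 :=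
        ⟨⟨(j - 1) / 2, by omega⟩, by simp only; omega⟩
      rw [Finset.prod_eq_zero (Finset.mem_univ i₀), mul_zero]
      rcases hi₀ with rfl | rfl
      · simp only [hval, hθv]
      · simp only [hval, hθv']
  change _ • contactProd α θ n (fun i => b (w (σ i))) = 0
  rw [this, smul_zero]

theorem flatLin_bijective [FiniteDimensional ℝ V] {n : ℕ} (hV : Module.finrank ℝ V = 2 * n + 1)
    {α : Module.Dual ℝ V} {θ : V [⋀^Fin 2]→ₗ[ℝ] ℝ} (h : wedgePow α θ n ≠ 0) :
    Function.Bijective (flatLin α θ) := by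
  have hi := flatLin_injective hV h
  exact ⟨hi, (LinearMap.injective_iff_surjective_of_finrank_eq_finrank
    (by rw [Subspace.dual_finrank_eq])).1 hi⟩

/-- A skew form on an odd-dimensional space has a kernel. -/
theorem exists_contract_eq_zero [FiniteDimensional ℝ V] {n : ℕ}
    (hV : Module.finrank ℝ V = 2 * n + 1) (θ : V [⋀^Fin 2]→ₗ[ℝ] ℝ) :
    ∃ v : V, v ≠ 0 ∧ contract θ v = 0 := by
  let b := Module.finBasisOfFinrankEq ℝ V hV
  let A : Matrix (Fin (2 * n + 1)) (Fin (2 * n + 1)) ℝ := fun i j => contract θ (b i) (b j)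
  have hA : A.transpose = -A := by
    ext i j
    exact contract_antisymm θ (b j) (b i)
  have hdet : A.det = 0 := by
    have h1 : A.det = -A.det := by
      conv_lhs => rw [← Matrix.det_transpose, hA, Matrix.det_neg]
      simp [pow_add, pow_mul]
    linarith
  obtain ⟨c, hc0, hc⟩ := Matrix.exists_mulVec_eq_zero_iff.2 hdet
  refine ⟨∑ j, c j • b j, fun h0 => hc0 ?_, ?_⟩
  · ext j
    have := Fintype.linearIndependent_iff.1 b.linearIndependent c h0 j
    simpa using this
  · refine b.ext fun i => ?_
    rw [contract_antisymm, map_sum, LinearMap.zero_apply, neg_eq_zero]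
    have := congrFun hc i
    simpa [Matrix.mulVec, dotProduct, A, mul_comm] using this

theorem existsUnique_reeb [FiniteDimensional ℝ V] {n : ℕ} (hV : Module.finrank ℝ V = 2 * n + 1)
    {α : Module.Dual ℝ V} {θ : V [⋀^Fin 2]→ₗ[ℝ] ℝ} (h : wedgePow α θ n ≠ 0) :
    ∃! v : V, contract θ v = 0 ∧ α v = 1 := by
  have hinj := flatLin_injective hV h
  obtain ⟨w, hw0, hw⟩ := exists_contract_eq_zero hV θ
  have hαw : α w ≠ 0 := fun h0 => hw0 <| hinj <| by
    rw [map_zero]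
    simp [flatLin, hw, h0]
  refine ⟨(α w)⁻¹ • w, ⟨?_, by simp [hαw]⟩, fun u hu => hinj ?_⟩
  · ext x
    rw [contract_antisymm, map_smul, contract_antisymm, hw]
    simp
  · rw [map_smul]
    simp [flatLin, hu.1, hu.2, hw, smul_smul, hαw]

end LinearAlgebra

section Manifold

variable {m : ℕ} {M : Type*} [TopologicalSpace M]
  [ChartedSpace (EuclideanSpace ℝ (Fin m)) M]

theorem finiteDimensional_tangentSpace (x : M) :
    FiniteDimensional ℝ (TangentSpace (𝓡 m) x) :=
  inferInstanceAs (FiniteDimensional ℝ (EuclideanSpace ℝ (Fin m)))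

theorem finrank_tangentSpace (x : M) : Module.finrank ℝ (TangentSpace (𝓡 m) x) = m :=
  finrank_euclideanSpace_fin (𝕜 := ℝ) (n := m)

/-- The exterior derivative of a `k`-form on a manifold: read the form in the preferred chart at
`x`, differentiate there, and pull the result back to `T_x M`. -/
def exteriorDerivative {k : ℕ} (ζ : (x : M) → TangentSpace (𝓡 m) x [⋀^Fin k]→L[ℝ] ℝ) (x : M) :
    TangentSpace (𝓡 m) x [⋀^Fin (k + 1)]→L[ℝ] ℝ :=
  (extDeriv (fun y : EuclideanSpace ℝ (Fin m) =>
      (ζ ((extChartAt (𝓡 m) x).symm y)).compContinuousLinearMap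
        (mfderiv 𝓘(ℝ, EuclideanSpace ℝ (Fin m)) (𝓡 m) (extChartAt (𝓡 m) x).symm y))
    (extChartAt (𝓡 m) x x)).compContinuousLinearMap
      (mfderiv (𝓡 m) 𝓘(ℝ, EuclideanSpace ℝ (Fin m)) (extChartAt (𝓡 m) x) x)

/-- The exterior derivative `dη` of a `1`-form `η`. -/
def dOneForm (η : (x : M) → TangentSpace (𝓡 m) x →L[ℝ] ℝ) (x : M) :
    TangentSpace (𝓡 m) x [⋀^Fin 2]→L[ℝ] ℝ :=
  exteriorDerivative (fun y =>
    ContinuousAlternatingMap.ofSubsingleton ℝ (TangentSpace (𝓡 m) y) ℝ (0 : Fin 1) (η y)) x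

/-- A contact form on a `(2n+1)`-dimensional manifold: a smooth `1`-form `η` such that
`η ∧ (dη)ⁿ` vanishes nowhere. -/
structure ContactForm (n : ℕ) (M : Type*) [TopologicalSpace M]
    [ChartedSpace (EuclideanSpace ℝ (Fin (2 * n + 1))) M]
    [IsManifold (𝓡 (2 * n + 1)) ∞ M] where
  /-- The underlying `1`-form. -/
  form : (x : M) → TangentSpace (𝓡 (2 * n + 1)) x →L[ℝ] ℝ
  contMDiff_form : ContMDiff (𝓡 (2 * n + 1))
    ((𝓡 (2 * n + 1)).prod 𝓘(ℝ, EuclideanSpace ℝ (Fin (2 * n + 1)) →L[ℝ] ℝ)) ∞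
    (fun x => Bundle.TotalSpace.mk' (EuclideanSpace ℝ (Fin (2 * n + 1)) →L[ℝ] ℝ)
      (E := fun y => TangentSpace (𝓡 (2 * n + 1)) y →L[ℝ] Bundle.Trivial M ℝ y) x (form x))
  wedgePow_ne_zero (x : M) :
    wedgePow (form x).toLinearMap (dOneForm form x).toAlternatingMap n ≠ 0

end Manifold

section Contact

variable {n : ℕ} {M : Type*} [TopologicalSpace M]
  [ChartedSpace (EuclideanSpace ℝ (Fin (2 * n + 1))) M]
  [IsManifold (𝓡 (2 * n + 1)) ∞ M]

/-- The `2`-form `dη` at `x`. -/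
def ContactForm.d (η : ContactForm n M) (x : M) :
    TangentSpace (𝓡 (2 * n + 1)) x [⋀^Fin 2]→ₗ[ℝ] ℝ :=
  (dOneForm η.form x).toAlternatingMap

theorem ContactForm.existsUnique_reeb (η : ContactForm n M) (x : M) :
    ∃! v : TangentSpace (𝓡 (2 * n + 1)) x, contract (η.d x) v = 0 ∧ η.form x v = 1 :=
  haveI := finiteDimensional_tangentSpace (m := 2 * n + 1) x
  ContactGeometry.existsUnique_reeb (finrank_tangentSpace x) (η.wedgePow_ne_zero x)

/-- The Reeb vector field: the unique vector field `R` with `ι_R dη = 0` and `η(R) = 1`. -/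
def ContactForm.reeb (η : ContactForm n M) (x : M) : TangentSpace (𝓡 (2 * n + 1)) x :=
  Classical.choose (η.existsUnique_reeb x).exists

/-- The isomorphism `♭ : T_x M → T_x^* M`, `v ↦ ι_v dη + η(v) η`. -/
def ContactForm.flat (η : ContactForm n M) (x : M) :
    TangentSpace (𝓡 (2 * n + 1)) x ≃ₗ[ℝ] Module.Dual ℝ (TangentSpace (𝓡 (2 * n + 1)) x) :=
  haveI := finiteDimensional_tangentSpace (m := 2 * n + 1) x
  LinearEquiv.ofBijective (flatLin (η.form x).toLinearMap (η.d x))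
    (flatLin_bijective (finrank_tangentSpace x) (η.wedgePow_ne_zero x))

/-- The differential `df` of a function at `x`. -/
def differential (f : M → ℝ) (x : M) : Module.Dual ℝ (TangentSpace (𝓡 (2 * n + 1)) x) :=
  (mfderiv (𝓡 (2 * n + 1)) 𝓘(ℝ, ℝ) f x).toLinearMap

/-- The Hamiltonian vector field of `f`: `♭(X_f) = df - (R(f) + f) η`. -/
def ContactForm.hamiltonianField (η : ContactForm n M) (f : M → ℝ) (x : M) :
    TangentSpace (𝓡 (2 * n + 1)) x :=
  (η.flat x).symm
    (differential f x - (differential f x (η.reeb x) + f x) • (η.form x).toLinearMap)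

/-- The bivector `Λ(α, β) = -dη(♭⁻¹ α, ♭⁻¹ β)`. -/
def ContactForm.bivector (η : ContactForm n M) (x : M)
    (α β : Module.Dual ℝ (TangentSpace (𝓡 (2 * n + 1)) x)) : ℝ :=
  -η.d x ![(η.flat x).symm α, (η.flat x).symm β]

/-- The Jacobi bracket `{f, g} = Λ(df, dg) - f R(g) + g R(f)`. -/
def ContactForm.jacobiBracket (η : ContactForm n M) (f g : M → ℝ) (x : M) : ℝ :=
  η.bivector x (differential f x) (differential g x)
    - f x * differential g x (η.reeb x) + g x * differential f x (η.reeb x)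

/-- A smooth function `f` is dissipated for `(M, η, H)` if `{H, f} = 0`. -/
def IsDissipated (η : ContactForm n M) (H f : M → ℝ) : Prop :=
  ContMDiff (𝓡 (2 * n + 1)) 𝓘(ℝ, ℝ) ∞ f ∧ ∀ x, η.jacobiBracket H f x = 0

/-- A dynamical symmetry of `(M, η, H)`: a smooth vector field `X` with `η([X_H, X]) = 0`. -/
def IsDynamicalSymmetry (η : ContactForm n M) (H : M → ℝ)
    (X : (x : M) → TangentSpace (𝓡 (2 * n + 1)) x) : Prop :=
  ContMDiff (𝓡 (2 * n + 1)) (𝓡 (2 * n + 1)).tangent ∞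
      (fun x => (⟨x, X x⟩ : TangentBundle (𝓡 (2 * n + 1)) M)) ∧
    ∀ x, η.form x
      (VectorField.mlieBracket (𝓡 (2 * n + 1)) (η.hamiltonianField H) X x) = 0

/-- `Φ^* η = η`. -/
def ContactForm.IsPreservedBy (η : ContactForm n M) (Φ : M → M) : Prop :=
  ∀ (x : M) (v : TangentSpace (𝓡 (2 * n + 1)) x),
    η.form (Φ x) (mfderiv (𝓡 (2 * n + 1)) (𝓡 (2 * n + 1)) Φ x v) = η.form x v

end Contact

section LieGroup

variable {k : ℕ} {G : Type*} [TopologicalSpace G] [ChartedSpace (EuclideanSpace ℝ (Fin k)) G]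

theorem hasMFDerivAt_comp_smulRight {m : ℕ} {M : Type*} [TopologicalSpace M]
    [ChartedSpace (EuclideanSpace ℝ (Fin m)) M]
    {γ : ℝ → G} {t : ℝ} {v : TangentSpace (𝓡 k) (γ t)}
    (hγ : HasMFDerivAt 𝓘(ℝ, ℝ) (𝓡 k) γ t ((1 : ℝ →L[ℝ] ℝ).smulRight v)) {f : G → M}
    (hf : MDifferentiableAt (𝓡 k) (𝓡 m) f (γ t)) :
    HasMFDerivAt 𝓘(ℝ, ℝ) (𝓡 m) (f ∘ γ) t
      ((1 : ℝ →L[ℝ] ℝ).smulRight (mfderiv (𝓡 k) (𝓡 m) f (γ t) v)) := by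
  have h := hf.hasMFDerivAt.comp t hγ
  have he : (mfderiv (𝓡 k) (𝓡 m) f (γ t)).comp ((1 : ℝ →L[ℝ] ℝ).smulRight v) =
      (1 : ℝ →L[ℝ] ℝ).smulRight (mfderiv (𝓡 k) (𝓡 m) f (γ t) v) := by
    refine ContinuousLinearMap.ext fun s => ?_
    exact (mfderiv (𝓡 k) (𝓡 m) f (γ t)).map_smul s v
  exact he ▸ h

variable [Group G] [LieGroup (𝓡 k) ∞ G]

theorem mulInvariantVectorField_mul (ξ : GroupLieAlgebra (𝓡 k) G) (g h : G) :
    mulInvariantVectorField ξ (g * h) =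
      mfderiv (𝓡 k) (𝓡 k) (g * ·) h (mulInvariantVectorField ξ h) := by
  have hd (a b : G) : MDifferentiableAt (𝓡 k) (𝓡 k) (a * ·) b :=
    (contMDiff_mul_left (I := 𝓡 k) (n := ∞) (a := a)).contMDiffAt.mdifferentiableAt (by simp)
  have hcomp : (g * h * ·) = (g * ·) ∘ (h * · : G → G) := by
    funext a
    exact mul_assoc g h a
  have hh := mfderiv_comp_of_eq (I := 𝓡 k) (I' := 𝓡 k) (I'' := 𝓡 k) (x := (1 : G))
    (hd g h) (hd h 1) (mul_one h)
  unfold mulInvariantVectorField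
  rw [hcomp, hh]
  exact congrArg (fun b : G => (mfderiv (𝓡 k) (𝓡 k) (g * ·) b :
      EuclideanSpace ℝ (Fin k) →L[ℝ] EuclideanSpace ℝ (Fin k))
    (mfderiv (𝓡 k) (𝓡 k) (h * ·) (1 : G) ξ : EuclideanSpace ℝ (Fin k))) (mul_one h)

theorem contMDiff_mulInvariant (ξ : GroupLieAlgebra (𝓡 k) G) :
    ContMDiff (𝓡 k) (𝓡 k).tangent 1
      (fun g : G => (⟨g, mulInvariantVectorField ξ g⟩ : TangentBundle (𝓡 k) G)) := by
  have : LieGroup (𝓡 k) (minSmoothness ℝ 3) G := by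
    rw [minSmoothness_of_isRCLikeNormedField]
    infer_instance
  refine (contMDiff_mulInvariantVectorField ξ).of_le ?_
  rw [minSmoothness_of_isRCLikeNormedField]
  exact one_le_two

theorem exists_oneParameter [T2Space G] (ξ : GroupLieAlgebra (𝓡 k) G) :
    ∃ γ : ℝ → G, γ 0 = 1 ∧
      IsMIntegralCurve (I := 𝓡 k) γ (mulInvariantVectorField ξ) := by
  have hv := contMDiff_mulInvariant ξ
  obtain ⟨γ, hγ0, hγ⟩ := exists_isMIntegralCurveAt_of_contMDiffAt_boundaryless (t₀ := 0)
    (hv.contMDiffAt (x := 1))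
  rw [isMIntegralCurveAt_iff'] at hγ
  obtain ⟨ε, hε, hγ⟩ := hγ
  refine exists_isMIntegralCurve_of_isMIntegralCurveOn hv hε (fun g => ?_) 1
  refine ⟨(g * ·) ∘ γ, by simp [hγ0], fun t ht => ?_⟩
  have hd : MDifferentiableAt (𝓡 k) (𝓡 k) (g * ·) (γ t) :=
    (contMDiff_mul_left (I := 𝓡 k) (n := ∞) (a := g)).contMDiffAt.mdifferentiableAt (by simp)
  have ht' : t ∈ Metric.ball (0 : ℝ) ε := by rwa [Real.ball_eq_Ioo, zero_sub, zero_add]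
  have h1 := (hγ t ht').hasMFDerivAt (Metric.isOpen_ball.mem_nhds ht')
  have h2 := hasMFDerivAt_comp_smulRight h1 hd
  rw [← mulInvariantVectorField_mul] at h2
  exact h2.hasMFDerivWithinAt

/-- The one-parameter subgroup of `ξ`: the integral curve through `1` of the left-invariant
vector field of `ξ`. -/
def oneParameter [T2Space G] (ξ : GroupLieAlgebra (𝓡 k) G) : ℝ → G :=
  Classical.choose (exists_oneParameter ξ)

/-- The exponential map of a Lie group. -/
def lieExp [T2Space G] (ξ : GroupLieAlgebra (𝓡 k) G) : G := oneParameter ξ 1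

theorem lieExp_smul [T2Space G] (ξ : GroupLieAlgebra (𝓡 k) G) (t : ℝ) :
    lieExp (t • ξ) = oneParameter ξ t := by
  have h1 := Classical.choose_spec (exists_oneParameter ξ)
  have h2 := Classical.choose_spec (exists_oneParameter (t • ξ))
  have h3 := h1.2.comp_mul t
  have he : t • mulInvariantVectorField ξ = mulInvariantVectorField (G := G) (t • ξ) := by
    funext g
    exact ((mfderiv (𝓡 k) (𝓡 k) (g * ·) (1 : G)).map_smul t ξ).symm
  rw [he] at h3
  have h4 := isMIntegralCurve_Ioo_eq_of_contMDiff_boundaryless (t₀ := 0)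
    (contMDiff_mulInvariant (t • ξ)) h2.2 h3 (by simp [h1.1, h2.1])
  have h5 := congrFun h4 1
  simpa [lieExp, oneParameter] using h5

section Action

variable {m : ℕ} {M : Type*} [TopologicalSpace M] [ChartedSpace (EuclideanSpace ℝ (Fin m)) M]
  [MulAction G M]

/-- The infinitesimal generator `ξ_M(x) = d/dt|₀ (exp(tξ) x)`. -/
def infinitesimalGenerator [T2Space G] (ξ : GroupLieAlgebra (𝓡 k) G) (x : M) :
    TangentSpace (𝓡 m) x :=
  mfderiv 𝓘(ℝ, ℝ) (𝓡 m) (fun t : ℝ => lieExp (t • ξ) • x) 0 (1 : ℝ)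

/-- `ξ_M(x)` depends linearly on `ξ`. -/
theorem infinitesimalGenerator_linear [T2Space G] [ContMDiffSMul (𝓡 k) (𝓡 m) ∞ G M] (x : M) :
    ∃ L : GroupLieAlgebra (𝓡 k) G →ₗ[ℝ] TangentSpace (𝓡 m) x,
      ∀ ξ, L ξ = infinitesimalGenerator ξ x := by
  refine ⟨(mfderiv (𝓡 k) (𝓡 m) (fun g : G => g • x) 1).toLinearMap.comp
    LinearMap.id, fun ξ => ?_⟩
  have hd (g : G) : MDifferentiableAt (𝓡 k) (𝓡 m) (fun g : G => g • x) g :=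
    ((contMDiff_smul (I := 𝓡 k) (I' := 𝓡 m) (n := ∞) (G := G) (M := M)).comp
      (contMDiff_id.prodMk contMDiff_const)).contMDiffAt.mdifferentiableAt (by simp)
  have h1 := Classical.choose_spec (exists_oneParameter ξ)
  have h2 := hasMFDerivAt_comp_smulRight (h1.2 0) (hd _)
  have hf : (fun t : ℝ => lieExp (t • ξ) • x) = (fun g : G => g • x) ∘ oneParameter ξ := by
    funext t
    rw [lieExp_smul]
    rfl
  have h3 (g : G) (hg : g = 1) :
      (mfderiv (𝓡 k) (𝓡 m) (fun g : G => g • x) g (mulInvariantVectorField ξ g) :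
        EuclideanSpace ℝ (Fin m)) = mfderiv (𝓡 k) (𝓡 m) (fun g : G => g • x) 1 ξ := by
    subst hg
    have h4 : mulInvariantVectorField ξ (1 : G) = ξ := by
      unfold mulInvariantVectorField
      have : ((1 : G) * ·) = (id : G → G) := by
        funext a
        exact one_mul a
      rw [this, mfderiv_id]
      rfl
    rw [h4]
  unfold infinitesimalGenerator
  rw [hf]
  refine (h3 _ h1.1).symm.trans ?_
  have h5 := congrArg (fun A : ℝ →L[ℝ] EuclideanSpace ℝ (Fin m) => A 1) h2.mfderiv
  refine Eq.trans ?_ h5.symm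
  exact (one_smul ℝ _).symm

end Action

section Momentum

variable {n : ℕ} {M : Type*} [TopologicalSpace M]
  [ChartedSpace (EuclideanSpace ℝ (Fin (2 * n + 1))) M] [IsManifold (𝓡 (2 * n + 1)) ∞ M]
  [T2Space G] [MulAction G M] [ContMDiffSMul (𝓡 k) (𝓡 (2 * n + 1)) ∞ G M]

/-- The momentum map `J : M → 𝔤^*`, `J(x)(ξ) = -η_x(ξ_M(x))`. -/
def momentumMap (η : ContactForm n M) (x : M) : Module.Dual ℝ (GroupLieAlgebra (𝓡 k) G) where
  toFun ξ := -η.form x (infinitesimalGenerator ξ x)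
  map_add' ξ ζ := by
    obtain ⟨L, hL⟩ := infinitesimalGenerator_linear (k := k) (G := G) (m := 2 * n + 1) x
    rw [← hL, ← hL, ← hL, map_add, map_add, neg_add]
  map_smul' c ξ := by
    obtain ⟨L, hL⟩ := infinitesimalGenerator_linear (k := k) (G := G) (m := 2 * n + 1) x
    rw [← hL, ← hL, map_smul, map_smul, smul_neg, RingHom.id_apply]

/-- The component `Ĵ(ξ)` of the momentum map: `Ĵ(ξ)(x) = J(x)(ξ)`. -/
def momentumComponent (η : ContactForm n M) (ξ : GroupLieAlgebra (𝓡 k) G) (x : M) : ℝ :=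
  momentumMap η x ξ

end Momentum
end LieGroup
end
end ContactGeometry

/-!
Write `X = ξ_M` and `f = Ĵ(ξ) = -η(X)`. Invariance of `η` under the action gives `L_X η = 0`, and
invariance of `H` gives `X(H) = 0`; everything else is Cartan calculus.

*Dissipation.* Cartan's formula turns `L_X η = 0` into `df = ι_X dη`
(`differential_momentumComponent`), hence `♭⁻¹(df) = X + f R`, and `{H, f} = 0` is then linear
algebra at each point, using `dH(X) = 0` (`ContactForm.jacobiBracket_eq_zero`).

*Dynamical symmetry.* From `♭(v)(R) = η(v)` one gets `η(X_H) = -H`. Then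
`0 = (L_X η)(X_H) = X(η(X_H)) - η([X, X_H]) = -X(H) + η([X_H, X])`, so `η([X_H, X]) = 0`
(`form_mlieBracket_hamiltonianField`).

Both arguments are carried out in the preferred chart at a point `x₀`. There `L_X η = 0` reads
`Dα(X) v + α(DX v) = 0`, where `α` is the coordinate expression of `η`. No flow is used: the action
is read in charts of `G` and `M` as a smooth family of local maps `F(q, ·)`, whose derivative in `q`
at the identity along `ξ` is `X`, and the identity `F(q, ·)^* α = α` is differentiated in `q`
(`lieDeriv_form_eq_zero`, `lieDeriv_formInChart_eq_zero`).

For the bracket to be meaningful `X_H` has to be differentiable. It solves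
`♭(X_H) = dH - (R(H) + H) η` with `♭` invertible, so this follows once `♭` is known to vary smoothly
in a fixed chart, that is, once `dη`, which is defined through a chart depending on the point, is
shown to be computed by every chart (`dOneForm_apply_chartSymmDeriv`, `ContactForm.differentiableAt_hamiltonianField`).
-/

namespace ContactGeometry
open Filter Topology
noncomputable section

/-! ### One-forms on a vector space -/

section VectorSpace
variable {E P : Type*} [NormedAddCommGroup E] [NormedSpace ℝ E]
  [NormedAddCommGroup P] [NormedSpace ℝ P]

theorem extDeriv_ofSubsingleton_apply {α : E → E →L[ℝ] ℝ} {y : E} (hα : DifferentiableAt ℝ α y)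
    (u v : E) :
    extDeriv (fun z => ContinuousAlternatingMap.ofSubsingleton ℝ E ℝ (0 : Fin 1) (α z)) y ![u, v] =
      fderiv ℝ α y u v - fderiv ℝ α y v u := by
  have h : DifferentiableAt ℝ
      (fun z => ContinuousAlternatingMap.ofSubsingleton ℝ E ℝ (0 : Fin 1) (α z)) y :=
    ((ContinuousAlternatingMap.ofSubsingletonLIE (𝕜 := ℝ) (E := E) (F := ℝ)
      (0 : Fin 1)).toContinuousLinearEquiv.differentiableAt).comp y hα
  rw [extDeriv_apply h]
  have hc (w w' : E) : fderiv ℝ (fun z => α z w) y w' = fderiv ℝ α y w' w := by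
    rw [fderiv_clm_apply hα (differentiableAt_const _)]
    simp
  simp [Fin.sum_univ_two, hc, Fin.removeNth, sub_eq_add_neg]

theorem fderiv_form_apply_field {α : E → E →L[ℝ] ℝ} {X : E → E} {y : E}
    (hα : DifferentiableAt ℝ α y) (hX : DifferentiableAt ℝ X y) (v : E) :
    fderiv ℝ (fun z => α z (X z)) y v = fderiv ℝ α y v (X y) + α y (fderiv ℝ X y v) := by
  rw [fderiv_clm_apply hα hX]
  simp [add_comm]

/-- Cartan calculus for the Lie derivative, in a vector space. Let `F q` be a family of local maps
with `F p = id` that preserves the form `α` at `y`, and let `X = ∂F/∂q (w)` at `q = p`. Then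
`(L_X α)(v) = Dα(X) v + α(DX v)` vanishes. This is the derivative of `F(q)^* α = α` in `q`; the
symmetry of the second derivative of `F` turns `∂_q ∂_y F` into `DX`. -/
theorem lieDeriv_form_eq_zero {α : E → E →L[ℝ] ℝ} {F : P × E → E} {p : P} {y : E}
    (hF : ContDiffAt ℝ 2 F (p, y)) (hFp : ∀ᶠ z in 𝓝 y, F (p, z) = z)
    (hα : DifferentiableAt ℝ α y) {v : E}
    (hinv : ∀ᶠ q in 𝓝 p, α (F (q, y)) (fderiv ℝ F (q, y) (0, v)) = α y v) (w : P) :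
    fderiv ℝ α y (fderiv ℝ F (p, y) (w, 0)) v +
      α y (fderiv ℝ (fun z => fderiv ℝ F (p, z) (w, 0)) y v) = 0 := by
  have hy : F (p, y) = y := hFp.self_of_nhds
  have hFd : HasFDerivAt F (fderiv ℝ F (p, y)) (p, y) :=
    (hF.differentiableAt (by norm_num)).hasFDerivAt
  have hF2 : HasFDerivAt (fderiv ℝ F) (fderiv ℝ (fderiv ℝ F) (p, y)) (p, y) :=
    ((hF.fderiv_right (m := 1) (by norm_num)).differentiableAt (by norm_num)).hasFDerivAt
  have hsymm := hF.isSymmSndFDerivAt (by simp)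
  have hl : HasFDerivAt (fun q : P => (q, y)) (ContinuousLinearMap.inl ℝ P E) p :=
    hasFDerivAt_prodMk_left p y
  have hr : HasFDerivAt (fun z : E => (p, z)) (ContinuousLinearMap.inr ℝ P E) y :=
    hasFDerivAt_prodMk_right p y
  have hv : fderiv ℝ F (p, y) (0, v) = v := by
    have h1 := hFd.comp y hr
    have h2 : HasFDerivAt (F ∘ fun z => (p, z)) (ContinuousLinearMap.id ℝ E) y :=
      (hasFDerivAt_id y).congr_of_eventuallyEq hFp
    simpa using DFunLike.congr_fun (h1.unique h2) v
  have hX : fderiv ℝ (fun z => fderiv ℝ F (p, z) (w, 0)) y v =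
      fderiv ℝ (fderiv ℝ F) (p, y) (w, 0) (0, v) := by
    rw [hsymm.eq]
    have h1 := (hF2.comp y hr).clm_apply (hasFDerivAt_const (w, (0 : E)) y)
    have h2 := DFunLike.congr_fun h1.fderiv v
    simpa using h2
  have hα' : HasFDerivAt α (fderiv ℝ α y) (F (p, y)) := by
    rw [hy]
    exact hα.hasFDerivAt
  have hg := (hα'.comp p (hFd.comp p hl)).clm_apply
    ((hF2.comp p hl).clm_apply (hasFDerivAt_const ((0 : P), v) p))
  have h0 := hg.unique ((hasFDerivAt_const (α y v) p).congr_of_eventuallyEq hinv)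
  have h1 := DFunLike.congr_fun h0 w
  simp [hy, hv] at h1
  rw [hX]
  linarith

/-- Stated for an abstract normed space, to be instantiated at `E →L[ℝ] E →L[ℝ] ℝ`, where the
topological and the normed instances on the codomain do not unify by themselves. -/
theorem differentiableAt_sub_add {f g h : P → E} {y : P} (hf : DifferentiableAt ℝ f y)
    (hg : DifferentiableAt ℝ g y) (hh : DifferentiableAt ℝ h y) :
    DifferentiableAt ℝ (fun z => f z - g z + h z) y :=
  (hf.sub hg).add hh

theorem differentiableAt_clm_comp {F : Type*} [NormedAddCommGroup F] [NormedSpace ℝ F]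
    (L : E →L[ℝ] F) {f : P → E} {y : P} (hf : DifferentiableAt ℝ f y) :
    DifferentiableAt ℝ (fun z => L (f z)) y :=
  L.differentiableAt.comp y hf

theorem differentiableAt_flip {B : P → E →L[ℝ] E →L[ℝ] ℝ} {y : P} (hB : DifferentiableAt ℝ B y) :
    DifferentiableAt ℝ (fun z => (B z).flip) y :=
  differentiableAt_clm_comp (E := E →L[ℝ] E →L[ℝ] ℝ) (F := E →L[ℝ] E →L[ℝ] ℝ)
    (ContinuousLinearMap.flipₗᵢ ℝ E E ℝ).toContinuousLinearEquiv.toContinuousLinearMap hB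

/-- The map `z ↦ (u ↦ ι_u dα + α(u) α)` is differentiable where `α` is `C²`. -/
theorem differentiableAt_flat_of_contDiffAt {α : E → E →L[ℝ] ℝ} {y : E}
    (hα : ContDiffAt ℝ 2 α y) :
    DifferentiableAt ℝ
      (fun z => fderiv ℝ α z - (fderiv ℝ α z).flip + (α z).smulRight (α z)) y := by
  have h1 : DifferentiableAt ℝ (fderiv ℝ α) y :=
    (hα.fderiv_right (m := 1) (by norm_num)).differentiableAt (by simp)
  have h2 : DifferentiableAt ℝ α y := hα.differentiableAt (by simp)
  have h4 : DifferentiableAt ℝ (fun z => (α z).smulRight (α z)) y :=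
    DifferentiableAt.comp (F := (E →L[ℝ] ℝ) × (E →L[ℝ] ℝ)) (G := E →L[ℝ] E →L[ℝ] ℝ)
      (g := fun p : (E →L[ℝ] ℝ) × (E →L[ℝ] ℝ) => p.1.smulRight p.2) y
      (isBoundedBilinearMap_smulRight.differentiableAt _) (h2.prodMk h2)
  exact differentiableAt_sub_add (E := E →L[ℝ] E →L[ℝ] ℝ) h1 (differentiableAt_flip h1) h4

end VectorSpace

/-! ### Forms and vector fields in a chart -/

section Manifold
variable {m : ℕ} {M : Type*} [TopologicalSpace M]
  [ChartedSpace (EuclideanSpace ℝ (Fin m)) M]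

/-- The derivative of the inverse of the preferred chart at `x₀`, as an endomorphism of the model
space (the tangent spaces of `M` are copies of it). -/
def chartSymmDeriv (x₀ : M) (y : EuclideanSpace ℝ (Fin m)) :
    EuclideanSpace ℝ (Fin m) →L[ℝ] EuclideanSpace ℝ (Fin m) :=
  mfderiv 𝓘(ℝ, EuclideanSpace ℝ (Fin m)) (𝓡 m) (extChartAt (𝓡 m) x₀).symm y

/-- The derivative of the preferred chart at `x₀`. -/
def chartDeriv (x₀ : M) (x : M) :
    EuclideanSpace ℝ (Fin m) →L[ℝ] EuclideanSpace ℝ (Fin m) :=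
  mfderiv (𝓡 m) 𝓘(ℝ, EuclideanSpace ℝ (Fin m)) (extChartAt (𝓡 m) x₀) x

/-- A `1`-form read in the preferred chart at `x₀`. -/
def formInChart (β : (x : M) → TangentSpace (𝓡 m) x →L[ℝ] ℝ) (x₀ : M)
    (y : EuclideanSpace ℝ (Fin m)) : EuclideanSpace ℝ (Fin m) →L[ℝ] ℝ :=
  ContinuousLinearMap.comp (M₁ := EuclideanSpace ℝ (Fin m)) (M₂ := EuclideanSpace ℝ (Fin m))
    (β ((extChartAt (𝓡 m) x₀).symm y)) (chartSymmDeriv x₀ y)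

/-- A vector field read in the preferred chart at `x₀`. -/
def fieldInChart (X : (x : M) → TangentSpace (𝓡 m) x) (x₀ : M)
    (y : EuclideanSpace ℝ (Fin m)) : EuclideanSpace ℝ (Fin m) :=
  chartDeriv x₀ ((extChartAt (𝓡 m) x₀).symm y) (X ((extChartAt (𝓡 m) x₀).symm y))

/-- Tangent spaces at equal points are both the model space, so the values of a form at equal points
on equal model vectors agree; this avoids transporting along `x = x'`. -/
theorem form_congr (β : (x : M) → TangentSpace (𝓡 m) x →L[ℝ] ℝ) {x x' : M} (hx : x = x')
    {v v' : EuclideanSpace ℝ (Fin m)} (hv : v = v') :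
    β x v = β x' v' := by
  subst hx hv
  rfl

variable [IsManifold (𝓡 m) ∞ M]

theorem chartDeriv_comp_chartSymmDeriv {x₀ : M} {y : EuclideanSpace ℝ (Fin m)}
    (hy : y ∈ (extChartAt (𝓡 m) x₀).target) :
    (chartDeriv x₀ ((extChartAt (𝓡 m) x₀).symm y)).comp (chartSymmDeriv x₀ y) =
      ContinuousLinearMap.id ℝ _ := by
  have : IsManifold (𝓡 m) 1 M := .of_le (n := ∞) (by simp)
  have h := mfderiv_extChartAt_comp_mfderivWithin_extChartAt_symm (I := 𝓡 m) hy
  rw [ModelWithCorners.range_eq_univ, mfderivWithin_univ] at h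
  exact h

theorem chartSymmDeriv_comp_chartDeriv {x₀ : M} {y : EuclideanSpace ℝ (Fin m)}
    (hy : y ∈ (extChartAt (𝓡 m) x₀).target) :
    (chartSymmDeriv x₀ y).comp (chartDeriv x₀ ((extChartAt (𝓡 m) x₀).symm y)) =
      ContinuousLinearMap.id ℝ _ := by
  have : IsManifold (𝓡 m) 1 M := .of_le (n := ∞) (by simp)
  have h := mfderivWithin_extChartAt_symm_comp_mfderiv_extChartAt (I := 𝓡 m) hy
  rw [ModelWithCorners.range_eq_univ, mfderivWithin_univ] at h
  exact h

theorem chartSymmDeriv_self (x₀ : M) :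
    chartSymmDeriv x₀ (extChartAt (𝓡 m) x₀ x₀) = ContinuousLinearMap.id ℝ _ := by
  have : IsManifold (𝓡 m) 1 M := .of_le (n := ∞) (by simp)
  have h := mfderivWithin_range_extChartAt_symm (I := 𝓡 m) (x := x₀)
  rw [ModelWithCorners.range_eq_univ, mfderivWithin_univ] at h
  exact h

theorem chartDeriv_self (x₀ : M) : chartDeriv (m := m) x₀ x₀ =
    ContinuousLinearMap.id ℝ _ := by
  have : IsManifold (𝓡 m) 1 M := .of_le (n := ∞) (by simp)
  exact mfderiv_extChartAt_self (I := 𝓡 m) (x := x₀)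

theorem formInChart_fieldInChart (β : (x : M) → TangentSpace (𝓡 m) x →L[ℝ] ℝ)
    (X : (x : M) → TangentSpace (𝓡 m) x) {x₀ : M} {y : EuclideanSpace ℝ (Fin m)}
    (hy : y ∈ (extChartAt (𝓡 m) x₀).target) :
    formInChart β x₀ y (fieldInChart X x₀ y) =
      β ((extChartAt (𝓡 m) x₀).symm y) (X ((extChartAt (𝓡 m) x₀).symm y)) :=
  congrArg (β ((extChartAt (𝓡 m) x₀).symm y))
    (DFunLike.congr_fun (chartSymmDeriv_comp_chartDeriv hy) _)

theorem formInChart_self (β : (x : M) → TangentSpace (𝓡 m) x →L[ℝ] ℝ) (x₀ : M) :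
    formInChart β x₀ (extChartAt (𝓡 m) x₀ x₀) = β x₀ := by
  unfold formInChart
  rw [chartSymmDeriv_self]
  ext v
  exact congrArg (fun x : M => (β x : EuclideanSpace ℝ (Fin m) →L[ℝ] ℝ) v)
    (extChartAt_to_inv (I := 𝓡 m) x₀)

theorem fieldInChart_self (X : (x : M) → TangentSpace (𝓡 m) x) (x₀ : M) :
    fieldInChart X x₀ (extChartAt (𝓡 m) x₀ x₀) = X x₀ := by
  unfold fieldInChart
  rw [extChartAt_to_inv (I := 𝓡 m) x₀, chartDeriv_self]
  rfl

theorem contDiffAt_formInChart {β : (x : M) → TangentSpace (𝓡 m) x →L[ℝ] ℝ} {x₀ : M}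
    (hβ : ContMDiffAt (𝓡 m) ((𝓡 m).prod 𝓘(ℝ, EuclideanSpace ℝ (Fin m) →L[ℝ] ℝ)) ∞
      (fun x => Bundle.TotalSpace.mk' (EuclideanSpace ℝ (Fin m) →L[ℝ] ℝ)
        (E := fun y => TangentSpace (𝓡 m) y →L[ℝ] Bundle.Trivial M ℝ y) x (β x)) x₀) :
    ContDiffAt ℝ ∞ (formInChart β x₀) (extChartAt (𝓡 m) x₀ x₀) := by
  have : IsManifold (𝓡 m) 1 M := .of_le (n := ∞) (by simp)
  rw [contMDiffAt_hom_bundle] at hβ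
  have hs : ContMDiffAt 𝓘(ℝ, EuclideanSpace ℝ (Fin m)) (𝓡 m) ∞ (extChartAt (𝓡 m) x₀).symm
      (extChartAt (𝓡 m) x₀ x₀) :=
    (contMDiffOn_extChartAt_symm x₀).contMDiffAt (extChartAt_target_mem_nhds x₀)
  have h := ContMDiffAt.comp_of_eq hβ.2 hs (extChartAt_to_inv (I := 𝓡 m) x₀)
  refine ContDiffAt.congr_of_eventuallyEq h.contDiffAt ?_
  filter_upwards [extChartAt_target_mem_nhds (I := 𝓡 m) x₀] with y hy
  have hsrc : (extChartAt (𝓡 m) x₀).symm y ∈ (chartAt (EuclideanSpace ℝ (Fin m)) x₀).source := by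
    simpa using (extChartAt (𝓡 m) x₀).map_target hy
  have h2 := TangentBundle.symmL_trivializationAt (I := 𝓡 m) hsrc
  rw [ModelWithCorners.range_eq_univ, mfderivWithin_univ, (extChartAt (𝓡 m) x₀).right_inv hy] at h2
  ext v
  simp only [Function.comp_apply, ContinuousLinearMap.inCoordinates]
  rw [h2]
  simp
  rfl

/-! ### The exterior derivative in an arbitrary chart -/

theorem contMDiffAt_extChartAt_symm_of_mem {x₀ : M} {y : EuclideanSpace ℝ (Fin m)}
    (hy : y ∈ (extChartAt (𝓡 m) x₀).target) :
    ContMDiffAt 𝓘(ℝ, EuclideanSpace ℝ (Fin m)) (𝓡 m) ∞ (extChartAt (𝓡 m) x₀).symm y :=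
  (contMDiffOn_extChartAt_symm x₀).contMDiffAt ((isOpen_extChartAt_target x₀).mem_nhds hy)

theorem contMDiffAt_extChartAt_of_mem {x₀ x : M} (hx : x ∈ (extChartAt (𝓡 m) x₀).source) :
    ContMDiffAt (𝓡 m) 𝓘(ℝ, EuclideanSpace ℝ (Fin m)) ∞ (extChartAt (𝓡 m) x₀) x :=
  contMDiffAt_extChartAt' (by simpa using hx)

theorem hasFDerivAt_extChartAt_comp_symm {x₀ x₁ : M} {y : EuclideanSpace ℝ (Fin m)}
    (hy : y ∈ (extChartAt (𝓡 m) x₀).target)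
    (hx : (extChartAt (𝓡 m) x₀).symm y ∈ (extChartAt (𝓡 m) x₁).source) :
    HasFDerivAt (extChartAt (𝓡 m) x₁ ∘ (extChartAt (𝓡 m) x₀).symm)
      ((chartDeriv x₁ ((extChartAt (𝓡 m) x₀).symm y)).comp (chartSymmDeriv x₀ y)) y := by
  have h1 := ((contMDiffAt_extChartAt_of_mem hx).mdifferentiableAt (by simp)).hasMFDerivAt
  have h2 := ((contMDiffAt_extChartAt_symm_of_mem hy).mdifferentiableAt (by simp)).hasMFDerivAt
  exact (h1.comp y h2).hasFDerivAt

theorem formInChart_eq_pullback (β : (x : M) → TangentSpace (𝓡 m) x →L[ℝ] ℝ)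
    {x₀ x₁ : M} {y : EuclideanSpace ℝ (Fin m)}
    (hy : y ∈ (extChartAt (𝓡 m) x₀).target)
    (hx : (extChartAt (𝓡 m) x₀).symm y ∈ (extChartAt (𝓡 m) x₁).source) :
    formInChart β x₀ y =
      (formInChart β x₁ (extChartAt (𝓡 m) x₁ ((extChartAt (𝓡 m) x₀).symm y))).comp
        (fderiv ℝ (extChartAt (𝓡 m) x₁ ∘ (extChartAt (𝓡 m) x₀).symm) y) := by
  rw [(hasFDerivAt_extChartAt_comp_symm hy hx).fderiv]
  have h := chartSymmDeriv_comp_chartDeriv ((extChartAt (𝓡 m) x₁).map_source hx)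
  rw [(extChartAt (𝓡 m) x₁).left_inv hx] at h
  ext v
  exact form_congr β ((extChartAt (𝓡 m) x₁).left_inv hx).symm
    (DFunLike.congr_fun h (chartSymmDeriv x₀ y v)).symm

/-- At the centre of the chart no transport is needed: `chartDeriv x x = id`. -/
theorem dOneForm_eq_extDeriv (β : (x : M) → TangentSpace (𝓡 m) x →L[ℝ] ℝ) (x : M)
    (u : Fin 2 → EuclideanSpace ℝ (Fin m)) :
    dOneForm β x u =
      extDeriv (fun y => ContinuousAlternatingMap.ofSubsingleton ℝ (EuclideanSpace ℝ (Fin m)) ℝ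
        (0 : Fin 1) (formInChart β x y)) (extChartAt (𝓡 m) x x) u := by
  have h : dOneForm β x u = extDeriv (fun y => ContinuousAlternatingMap.ofSubsingleton ℝ
      (EuclideanSpace ℝ (Fin m)) ℝ (0 : Fin 1) (formInChart β x y)) (extChartAt (𝓡 m) x x)
        (chartDeriv x x ∘ u) := rfl
  rw [h, chartDeriv_self]
  rfl

/-- `dβ` is computed by the usual formula in every chart, and not only in the one preferred at the
point, since the exterior derivative commutes with pullback along the change of charts. -/
theorem dOneForm_apply_chartSymmDeriv {β : (x : M) → TangentSpace (𝓡 m) x →L[ℝ] ℝ}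
    (hβ : ContMDiff (𝓡 m) ((𝓡 m).prod 𝓘(ℝ, EuclideanSpace ℝ (Fin m) →L[ℝ] ℝ)) ∞
      (fun x => Bundle.TotalSpace.mk' (EuclideanSpace ℝ (Fin m) →L[ℝ] ℝ)
        (E := fun y => TangentSpace (𝓡 m) y →L[ℝ] Bundle.Trivial M ℝ y) x (β x)))
    {x₀ : M} {y : EuclideanSpace ℝ (Fin m)} (hy : y ∈ (extChartAt (𝓡 m) x₀).target)
    (u v : EuclideanSpace ℝ (Fin m)) :
    dOneForm β ((extChartAt (𝓡 m) x₀).symm y) ![chartSymmDeriv x₀ y u, chartSymmDeriv x₀ y v] =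
      fderiv ℝ (formInChart β x₀) y u v - fderiv ℝ (formInChart β x₀) y v u := by
  set x₁ := (extChartAt (𝓡 m) x₀).symm y with hx₁
  have hx : (extChartAt (𝓡 m) x₀).symm y ∈ (extChartAt (𝓡 m) x₁).source :=
    mem_extChartAt_source x₁
  -- `τ` is the change of charts from the one at `x₀` to the one preferred at `x₁`
  set τ := extChartAt (𝓡 m) x₁ ∘ (extChartAt (𝓡 m) x₀).symm with hτ
  have hτy : τ y = extChartAt (𝓡 m) x₁ x₁ := rfl
  have hα : DifferentiableAt ℝ (formInChart β x₁) (τ y) :=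
    (contDiffAt_formInChart (hβ x₁)).differentiableAt (by simp)
  have hτs : ContDiffAt ℝ ∞ τ y :=
    ((contMDiffAt_extChartAt_of_mem hx).comp y (contMDiffAt_extChartAt_symm_of_mem hy)).contDiffAt
  have hτ2 : ContDiffAt ℝ 2 τ y := hτs.of_le ENat.LEInfty.out
  have hev : ∀ᶠ z in 𝓝 y, formInChart β x₀ z = (formInChart β x₁ (τ z)).comp (fderiv ℝ τ z) := by
    filter_upwards [(isOpen_extChartAt_target x₀).mem_nhds hy,
      (contMDiffAt_extChartAt_symm_of_mem hy).continuousAt.preimage_mem_nhds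
        (extChartAt_source_mem_nhds' hx)] with z hz hz'
    exact formInChart_eq_pullback β hz hz'
  have hτd : fderiv ℝ τ y = chartSymmDeriv x₀ y := by
    rw [(hasFDerivAt_extChartAt_comp_symm hy hx).fderiv, ← hx₁, chartDeriv_self]
    rfl
  have hα₀ : DifferentiableAt ℝ (formInChart β x₀) y := by
    refine DifferentiableAt.congr_of_eventuallyEq ?_ hev
    exact (hα.comp y (hτs.differentiableAt (by simp))).clm_comp
      ((hτ2.fderiv_right (m := 1) (by norm_num)).differentiableAt (by simp))
  have hα' : DifferentiableAt ℝ (fun z => ContinuousAlternatingMap.ofSubsingleton ℝ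
      (EuclideanSpace ℝ (Fin m)) ℝ (0 : Fin 1) (formInChart β x₁ z)) (τ y) :=
    ((ContinuousAlternatingMap.ofSubsingletonLIE (𝕜 := ℝ) (E := EuclideanSpace ℝ (Fin m)) (F := ℝ)
      (0 : Fin 1)).toContinuousLinearEquiv.differentiableAt).comp _ hα
  have hp := extDeriv_pullback hα' hτ2 (by simp)
  rw [← extDeriv_ofSubsingleton_apply hα₀]
  have hev' : (fun z => ContinuousAlternatingMap.ofSubsingleton ℝ
      (EuclideanSpace ℝ (Fin m)) ℝ (0 : Fin 1) (formInChart β x₀ z)) =ᶠ[𝓝 y]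
      fun z => (ContinuousAlternatingMap.ofSubsingleton ℝ
      (EuclideanSpace ℝ (Fin m)) ℝ (0 : Fin 1) (formInChart β x₁ (τ z))).compContinuousLinearMap
        (fderiv ℝ τ z) := by
    filter_upwards [hev] with z hz
    rw [hz]
    ext w
    rfl
  rw [hev'.extDeriv_eq, hp, hτd, hτy]
  refine (dOneForm_eq_extDeriv β x₁ _).trans ?_
  rw [ContinuousAlternatingMap.compContinuousLinearMap_apply]
  congr 1
  ext i : 1
  fin_cases i <;> rfl

/-! ### The Lie bracket in a chart -/

theorem chartSymmDeriv_fieldInChart (X : (x : M) → TangentSpace (𝓡 m) x) {x₀ : M}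
    {y : EuclideanSpace ℝ (Fin m)} (hy : y ∈ (extChartAt (𝓡 m) x₀).target) :
    chartSymmDeriv x₀ y (fieldInChart X x₀ y) = X ((extChartAt (𝓡 m) x₀).symm y) :=
  DFunLike.congr_fun (chartSymmDeriv_comp_chartDeriv hy) _

theorem mlieBracket_eq_lieBracket_fieldInChart (V W : (x : M) → TangentSpace (𝓡 m) x) (x₀ : M) :
    VectorField.mlieBracket (𝓡 m) V W x₀ =
      VectorField.lieBracket ℝ (fieldInChart V x₀) (fieldInChart W x₀)
        (extChartAt (𝓡 m) x₀ x₀) := by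
  have : IsManifold (𝓡 m) 1 M := .of_le (n := ∞) (by simp)
  -- the pullback of a vector field along the inverse chart, as a map of the model space to itself
  let pb (X : (x : M) → TangentSpace (𝓡 m) x) (y : EuclideanSpace ℝ (Fin m)) :
      EuclideanSpace ℝ (Fin m) :=
    VectorField.mpullbackWithin 𝓘(ℝ, EuclideanSpace ℝ (Fin m)) (𝓡 m) (extChartAt (𝓡 m) x₀).symm X
      (Set.range (𝓡 m)) y
  have key (X : (x : M) → TangentSpace (𝓡 m) x) :
      pb X =ᶠ[𝓝 (extChartAt (𝓡 m) x₀ x₀)] fieldInChart X x₀ := by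
    filter_upwards [extChartAt_target_mem_nhds (I := 𝓡 m) x₀] with y hy
    simp only [pb]
    rw [VectorField.mpullbackWithin_apply, ModelWithCorners.range_eq_univ, mfderivWithin_univ]
    have hi : (chartSymmDeriv x₀ y).inverse =
        chartDeriv x₀ ((extChartAt (𝓡 m) x₀).symm y) :=
      ContinuousLinearMap.inverse_eq (chartSymmDeriv_comp_chartDeriv hy)
        (chartDeriv_comp_chartSymmDeriv hy)
    exact DFunLike.congr_fun hi _
  have hid : (chartDeriv (m := m) x₀ x₀).inverse = ContinuousLinearMap.id ℝ _ := by
    rw [chartDeriv_self, ContinuousLinearMap.inverse_id]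
  have h1 : VectorField.mlieBracket (𝓡 m) V W x₀ = (chartDeriv (m := m) x₀ x₀).inverse
      (VectorField.lieBracketWithin ℝ (pb V) (pb W)
        ((extChartAt (𝓡 m) x₀).symm ⁻¹' Set.univ ∩ Set.range (𝓡 m)) (extChartAt (𝓡 m) x₀ x₀)) :=
    rfl
  rw [h1, hid, Set.preimage_univ, Set.univ_inter, ModelWithCorners.range_eq_univ,
    VectorField.lieBracketWithin_univ, ContinuousLinearMap.id_apply]
  exact (key V).lieBracket_vectorField_eq (key W)

end Manifold

/-! ### Pointwise identities for contact forms -/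

section Contact
variable {n : ℕ} {M : Type*} [TopologicalSpace M]
  [ChartedSpace (EuclideanSpace ℝ (Fin (2 * n + 1))) M]
  [IsManifold (𝓡 (2 * n + 1)) ∞ M]

theorem ContactForm.flat_apply (η : ContactForm n M) (x : M)
    (v w : TangentSpace (𝓡 (2 * n + 1)) x) :
    η.flat x v w = η.d x ![v, w] + η.form x v * η.form x w := by
  change contract (η.d x) v w + η.form x v * η.form x w = _
  rw [contract_apply]

theorem ContactForm.contract_reeb (η : ContactForm n M) (x : M) :
    contract (η.d x) (η.reeb x) = 0 :=
  (Classical.choose_spec (η.existsUnique_reeb x).exists).1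

theorem ContactForm.form_reeb (η : ContactForm n M) (x : M) : η.form x (η.reeb x) = 1 :=
  (Classical.choose_spec (η.existsUnique_reeb x).exists).2

theorem ContactForm.flat_reeb (η : ContactForm n M) (x : M) :
    η.flat x (η.reeb x) = (η.form x).toLinearMap := by
  ext w
  rw [flat_apply, ← contract_apply, contract_reeb, form_reeb]
  simp

theorem ContactForm.flat_apply_reeb (η : ContactForm n M) (x : M)
    (v : TangentSpace (𝓡 (2 * n + 1)) x) : η.flat x v (η.reeb x) = η.form x v := by
  rw [flat_apply, ← contract_apply, contract_antisymm, contract_reeb, form_reeb]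
  simp

theorem ContactForm.form_flat_symm (η : ContactForm n M) (x : M)
    (α : Module.Dual ℝ (TangentSpace (𝓡 (2 * n + 1)) x)) :
    η.form x ((η.flat x).symm α) = α (η.reeb x) := by
  rw [← flat_apply_reeb, LinearEquiv.apply_symm_apply]

theorem ContactForm.form_hamiltonianField (η : ContactForm n M) (H : M → ℝ) (x : M) :
    η.form x (η.hamiltonianField H x) = -H x := by
  unfold hamiltonianField
  rw [form_flat_symm, LinearMap.sub_apply, LinearMap.smul_apply]
  change _ - _ • η.form x (η.reeb x) = _
  rw [form_reeb, smul_eq_mul]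
  ring

/-- If `f = -η(X)`, `df = ι_X dη` and `X(H) = 0`, then `♭⁻¹(df) = X + f R`, so
`{H, f} = -dη(♭⁻¹(dH), X) + f R(H)`. As `0 = dH(X) = dη(♭⁻¹(dH), X) + R(H) η(X)`, this is zero. -/
theorem ContactForm.jacobiBracket_eq_zero (η : ContactForm n M) {H f : M → ℝ} {x : M}
    {X : TangentSpace (𝓡 (2 * n + 1)) x} (hf : f x = -η.form x X)
    (hdf : differential f x = contract (η.d x) X) (hH : differential H x X = 0) :
    η.jacobiBracket H f x = 0 := by
  have hsharp : (η.flat x).symm (differential f x) = X + f x • η.reeb x := by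
    rw [LinearEquiv.symm_apply_eq, map_add, map_smul, flat_reeb, hdf, hf]
    ext w
    rw [LinearMap.add_apply, flat_apply, contract_apply]
    change _ = _ + _ + -η.form x X * η.form x w
    ring
  set Y := (η.flat x).symm (differential H x) with hY
  have h1 : η.flat x Y X = 0 := by rw [hY, LinearEquiv.apply_symm_apply, hH]
  have h2 : η.form x Y = differential H x (η.reeb x) := form_flat_symm ..
  have h3 : differential f x (η.reeb x) = 0 := by
    rw [hdf, contract_antisymm, contract_reeb]
    simp
  unfold jacobiBracket bivector
  rw [← hY, hsharp, h3, ← contract_apply, map_add, map_smul, contract_antisymm _ _ (η.reeb x),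
    contract_reeb, contract_apply]
  rw [flat_apply, h2] at h1
  simp only [LinearMap.zero_apply, neg_zero, smul_zero, add_zero, mul_zero, sub_zero]
  rw [hf]
  linarith

/-! ### Differentiability of Hamiltonian vector fields -/

/-- The isomorphism `♭` of a contact form, read in the preferred chart at `x₀`: with `α` the form in
that chart, `u ↦ (v ↦ Dα(u) v - Dα(v) u + α(u) α(v))`. -/
def ContactForm.flatInChart (η : ContactForm n M) (x₀ : M)
    (y : EuclideanSpace ℝ (Fin (2 * n + 1))) :
    EuclideanSpace ℝ (Fin (2 * n + 1)) →L[ℝ] EuclideanSpace ℝ (Fin (2 * n + 1)) →L[ℝ] ℝ :=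
  fderiv ℝ (formInChart η.form x₀) y - (fderiv ℝ (formInChart η.form x₀) y).flip +
    (formInChart η.form x₀ y).smulRight (formInChart η.form x₀ y)

theorem ContactForm.flat_chartSymmDeriv (η : ContactForm n M) {x₀ : M}
    {y : EuclideanSpace ℝ (Fin (2 * n + 1))} (hy : y ∈ (extChartAt (𝓡 (2 * n + 1)) x₀).target)
    (u v : EuclideanSpace ℝ (Fin (2 * n + 1))) :
    η.flat ((extChartAt (𝓡 (2 * n + 1)) x₀).symm y) (chartSymmDeriv x₀ y u)
      (chartSymmDeriv x₀ y v) = η.flatInChart x₀ y u v := by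
  have h := dOneForm_apply_chartSymmDeriv η.contMDiff_form hy u v
  refine (η.flat_apply _ _ _).trans ?_
  refine (congrArg (· + _) h).trans ?_
  simp only [flatInChart, _root_.add_apply, _root_.sub_apply,
    ContinuousLinearMap.flip_apply, ContinuousLinearMap.smulRight_apply,
    _root_.smul_apply, smul_eq_mul]
  rfl

theorem ContactForm.isInvertible_flatInChart (η : ContactForm n M) {x₀ : M}
    {y : EuclideanSpace ℝ (Fin (2 * n + 1))}
    (hy : y ∈ (extChartAt (𝓡 (2 * n + 1)) x₀).target) :
    (η.flatInChart x₀ y).IsInvertible := by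
  have hinj : Function.Injective (η.flatInChart x₀ y) := by
    rw [injective_iff_map_eq_zero]
    intro u hu
    have h0 : η.flat ((extChartAt (𝓡 (2 * n + 1)) x₀).symm y) (chartSymmDeriv x₀ y u) = 0 := by
      ext w
      have hw := DFunLike.congr_fun (chartSymmDeriv_comp_chartDeriv hy) w
      have h1 := η.flat_chartSymmDeriv hy u
        (chartDeriv x₀ ((extChartAt (𝓡 (2 * n + 1)) x₀).symm y) w)
      rw [hu] at h1
      refine (congrArg _ hw).symm.trans h1
    have h1 : chartSymmDeriv x₀ y u = 0 :=
      (LinearEquiv.map_eq_zero_iff _).1 h0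
    have h2 := DFunLike.congr_fun (chartDeriv_comp_chartSymmDeriv hy) u
    rw [ContinuousLinearMap.comp_apply, h1, map_zero] at h2
    exact h2.symm
  have hfin : Module.finrank ℝ (EuclideanSpace ℝ (Fin (2 * n + 1))) =
      Module.finrank ℝ (EuclideanSpace ℝ (Fin (2 * n + 1)) →L[ℝ] ℝ) :=
    (InnerProductSpace.toDual ℝ
      (EuclideanSpace ℝ (Fin (2 * n + 1)))).toLinearEquiv.finrank_eq
  -- `♭` is injective, and a finite-dimensional space has the dimension of its dual
  exact ⟨(LinearEquiv.ofInjectiveOfFinrankEq (η.flatInChart x₀ y).toLinearMap hinj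
    hfin).toContinuousLinearEquiv, by ext; rfl⟩

theorem ContactForm.differentiableAt_flatInChart (η : ContactForm n M) (x₀ : M) :
    DifferentiableAt ℝ (η.flatInChart x₀) (extChartAt (𝓡 (2 * n + 1)) x₀ x₀) := by
  have h0 : ContDiffAt ℝ 2 (formInChart η.form x₀) (extChartAt (𝓡 (2 * n + 1)) x₀ x₀) :=
    (contDiffAt_formInChart (η.contMDiff_form x₀)).of_le ENat.LEInfty.out
  exact differentiableAt_flat_of_contDiffAt h0

/-- A vector field `X` is differentiable in the chart if the covector field `♭ X`, with coordinate
expression `b`, is: invert `♭` in the chart. -/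
theorem ContactForm.differentiableAt_fieldInChart (η : ContactForm n M) {x₀ : M}
    {X : (x : M) → TangentSpace (𝓡 (2 * n + 1)) x}
    {b : EuclideanSpace ℝ (Fin (2 * n + 1)) → EuclideanSpace ℝ (Fin (2 * n + 1)) →L[ℝ] ℝ}
    (hb : DifferentiableAt ℝ b (extChartAt (𝓡 (2 * n + 1)) x₀ x₀))
    (hX : ∀ y ∈ (extChartAt (𝓡 (2 * n + 1)) x₀).target, ∀ v,
      η.flat _ (X ((extChartAt (𝓡 (2 * n + 1)) x₀).symm y)) (chartSymmDeriv x₀ y v) = b y v) :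
    DifferentiableAt ℝ (fieldInChart X x₀) (extChartAt (𝓡 (2 * n + 1)) x₀ x₀) := by
  have hi : DifferentiableAt ℝ (fun y => (η.flatInChart x₀ y).inverse)
      (extChartAt (𝓡 (2 * n + 1)) x₀ x₀) := by
    have h1 := (η.isInvertible_flatInChart (mem_extChartAt_target
      (I := 𝓡 (2 * n + 1)) x₀)).contDiffAt_map_inverse (n := 1)
    exact (h1.differentiableAt (by simp)).comp _ (η.differentiableAt_flatInChart x₀)
  refine (hi.clm_apply hb).congr_of_eventuallyEq ?_
  filter_upwards [extChartAt_target_mem_nhds (I := 𝓡 (2 * n + 1)) x₀] with y hy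
  have h2 : b y = η.flatInChart x₀ y (fieldInChart X x₀ y) := by
    ext v
    rw [← η.flat_chartSymmDeriv hy, chartSymmDeriv_fieldInChart X hy, hX y hy]
  rw [h2, (η.isInvertible_flatInChart hy).inverse_apply_self]

theorem ContactForm.differentiableAt_reeb (η : ContactForm n M) (x₀ : M) :
    DifferentiableAt ℝ (fieldInChart η.reeb x₀) (extChartAt (𝓡 (2 * n + 1)) x₀ x₀) := by
  refine η.differentiableAt_fieldInChart (b := formInChart η.form x₀)
    ((contDiffAt_formInChart (η.contMDiff_form x₀)).differentiableAt (by simp)) fun y hy v => ?_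
  rw [flat_reeb]
  rfl

theorem fderiv_comp_extChartAt_symm {f : M → ℝ} (hf : MDifferentiable (𝓡 (2 * n + 1)) 𝓘(ℝ, ℝ) f)
    {x₀ : M} {y : EuclideanSpace ℝ (Fin (2 * n + 1))}
    (hy : y ∈ (extChartAt (𝓡 (2 * n + 1)) x₀).target) (v : EuclideanSpace ℝ (Fin (2 * n + 1))) :
    fderiv ℝ (f ∘ (extChartAt (𝓡 (2 * n + 1)) x₀).symm) y v =
      differential f ((extChartAt (𝓡 (2 * n + 1)) x₀).symm y) (chartSymmDeriv x₀ y v) := by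
  have h2 := ((contMDiffAt_extChartAt_symm_of_mem hy).mdifferentiableAt (by simp)).hasMFDerivAt
  let L : EuclideanSpace ℝ (Fin (2 * n + 1)) →L[ℝ] ℝ :=
    mfderiv (𝓡 (2 * n + 1)) 𝓘(ℝ, ℝ) f ((extChartAt (𝓡 (2 * n + 1)) x₀).symm y)
  have h : HasFDerivAt (f ∘ (extChartAt (𝓡 (2 * n + 1)) x₀).symm)
      (L.comp (chartSymmDeriv x₀ y)) y :=
    (HasMFDerivAt.comp y (hf ((extChartAt (𝓡 (2 * n + 1)) x₀).symm y)).hasMFDerivAt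
      h2).hasFDerivAt
  exact DFunLike.congr_fun h.fderiv v

/-- The Lie bracket is built from `fderiv` in a chart, so it has its intended meaning for `X_H` only
because of this. -/
theorem ContactForm.differentiableAt_hamiltonianField (η : ContactForm n M) {H : M → ℝ}
    (hH : ContMDiff (𝓡 (2 * n + 1)) 𝓘(ℝ, ℝ) ∞ H) (x₀ : M) :
    DifferentiableAt ℝ (fieldInChart (η.hamiltonianField H) x₀)
      (extChartAt (𝓡 (2 * n + 1)) x₀ x₀) := by
  set K := H ∘ (extChartAt (𝓡 (2 * n + 1)) x₀).symm with hK
  have hKs : ContDiffAt ℝ 2 K (extChartAt (𝓡 (2 * n + 1)) x₀ x₀) :=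
    (hH.contMDiffAt.comp _ (contMDiffAt_extChartAt_symm_of_mem
      (mem_extChartAt_target x₀))).contDiffAt.of_le ENat.LEInfty.out
  have hK1 := (hKs.fderiv_right (m := 1) (by norm_num)).differentiableAt (by simp)
  have hα : DifferentiableAt ℝ (formInChart η.form x₀) (extChartAt (𝓡 (2 * n + 1)) x₀ x₀) :=
    (contDiffAt_formInChart (η.contMDiff_form x₀)).differentiableAt (by simp)
  refine η.differentiableAt_fieldInChart (b := fun y => fderiv ℝ K y -
    (fderiv ℝ K y (fieldInChart η.reeb x₀ y) + K y) • formInChart η.form x₀ y)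
    (hK1.sub (((hK1.clm_apply (η.differentiableAt_reeb x₀)).add
      (hKs.differentiableAt (by simp))).smul hα)) fun y hy v => ?_
  have hd := hH.mdifferentiable (by simp)
  unfold hamiltonianField
  rw [LinearEquiv.apply_symm_apply, _root_.sub_apply, _root_.smul_apply,
    hK, fderiv_comp_extChartAt_symm hd hy, fderiv_comp_extChartAt_symm hd hy,
    chartSymmDeriv_fieldInChart _ hy]
  rfl

end Contact

/-! ### Infinitesimal generators of a smooth action -/

section Action
variable {k m : ℕ} {G : Type*} [TopologicalSpace G] [ChartedSpace (EuclideanSpace ℝ (Fin k)) G]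
  [Group G] {M : Type*} [TopologicalSpace M] [ChartedSpace (EuclideanSpace ℝ (Fin m)) M]
  [MulAction G M]

variable (G) in
/-- The action map `(g, x) ↦ g • x`, read in the preferred charts at `1 : G` and at `x₀ : M`. -/
def actionInChart (x₀ : M) (q : EuclideanSpace ℝ (Fin k) × EuclideanSpace ℝ (Fin m)) :
    EuclideanSpace ℝ (Fin m) :=
  extChartAt (𝓡 m) x₀ ((extChartAt (𝓡 k) (1 : G)).symm q.1 • (extChartAt (𝓡 m) x₀).symm q.2)

theorem smul_extChartAt_symm_self (x₀ : M) (y : EuclideanSpace ℝ (Fin m)) :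
    (extChartAt (𝓡 k) (1 : G)).symm (extChartAt (𝓡 k) (1 : G) 1) • (extChartAt (𝓡 m) x₀).symm y =
      (extChartAt (𝓡 m) x₀).symm y := by
  rw [extChartAt_to_inv, one_smul]

theorem actionInChart_self {x₀ : M} {y : EuclideanSpace ℝ (Fin m)}
    (hy : y ∈ (extChartAt (𝓡 m) x₀).target) :
    actionInChart G x₀ (extChartAt (𝓡 k) (1 : G) 1, y) = y := by
  unfold actionInChart
  rw [smul_extChartAt_symm_self, (extChartAt (𝓡 m) x₀).right_inv hy]

variable [ContMDiffSMul (𝓡 k) (𝓡 m) ∞ G M]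

theorem mdifferentiableAt_smul_const (x : M) (g : G) :
    MDifferentiableAt (𝓡 k) (𝓡 m) (fun g : G => g • x) g :=
  ((contMDiff_smul (I := 𝓡 k) (I' := 𝓡 m) (n := ∞) (G := G) (M := M)).comp
    (contMDiff_id.prodMk contMDiff_const)).contMDiffAt.mdifferentiableAt (by simp)

variable [LieGroup (𝓡 k) ∞ G]

/-- The generator only depends on the action near `1`, to first order; the exponential map is not
needed beyond this. -/
theorem infinitesimalGenerator_eq_mfderiv [T2Space G] (ξ : GroupLieAlgebra (𝓡 k) G) (x : M) :
    (infinitesimalGenerator ξ x : EuclideanSpace ℝ (Fin m)) =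
      mfderiv (𝓡 k) (𝓡 m) (fun g : G => g • x) 1 ξ := by
  have h1 := Classical.choose_spec (exists_oneParameter ξ)
  have h2 := hasMFDerivAt_comp_smulRight (h1.2 0) (mdifferentiableAt_smul_const (m := m) x _)
  have hf : (fun t : ℝ => lieExp (t • ξ) • x) = (fun g : G => g • x) ∘ oneParameter ξ := by
    funext t
    rw [lieExp_smul]
    rfl
  have h3 (g : G) (hg : g = 1) :
      (mfderiv (𝓡 k) (𝓡 m) (fun g : G => g • x) g (mulInvariantVectorField ξ g) :
        EuclideanSpace ℝ (Fin m)) = mfderiv (𝓡 k) (𝓡 m) (fun g : G => g • x) 1 ξ := by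
    subst hg
    have h4 : mulInvariantVectorField ξ (1 : G) = ξ := by
      unfold mulInvariantVectorField
      have : ((1 : G) * ·) = (id : G → G) := by
        funext a
        exact one_mul a
      rw [this, mfderiv_id]
      rfl
    rw [h4]
  unfold infinitesimalGenerator
  rw [hf]
  refine Eq.trans ?_ (h3 _ h1.1)
  have h5 := congrArg (fun A : ℝ →L[ℝ] EuclideanSpace ℝ (Fin m) => A 1) h2.mfderiv
  exact h5.trans (one_smul ℝ _)

/-- The generator is `x ↦ T(action)(ξ, 0ₓ)`, and the tangent map of the action is smooth. -/
theorem contMDiff_infinitesimalGenerator [T2Space G] [IsManifold (𝓡 m) ∞ M]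
    (ξ : GroupLieAlgebra (𝓡 k) G) :
    ContMDiff (𝓡 m) (𝓡 m).tangent ∞
      (fun x : M => (⟨x, infinitesimalGenerator ξ x⟩ : TangentBundle (𝓡 m) M)) := by
  have hsmul : ContMDiff ((𝓡 k).prod (𝓡 m)) (𝓡 m) ∞ (fun p : G × M => p.1 • p.2) :=
    contMDiff_smul
  let S₁ : M → TangentBundle (𝓡 k) G × TangentBundle (𝓡 m) M := fun x =>
    (⟨1, ξ⟩, Bundle.TotalSpace.mk' (EuclideanSpace ℝ (Fin m)) x 0)
  have hS₁ : ContMDiff (𝓡 m) ((𝓡 k).tangent.prod (𝓡 m).tangent) ∞ S₁ :=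
    contMDiff_const.prodMk (Bundle.contMDiff_zeroSection ℝ _)
  have h := ((hsmul.contMDiff_tangentMap (m := ∞) (by simp)).comp
    contMDiff_equivTangentBundleProd_symm).comp hS₁
  refine h.congr fun x => ?_
  have hv : (infinitesimalGenerator ξ x : EuclideanSpace ℝ (Fin m)) =
      mfderiv ((𝓡 k).prod (𝓡 m)) (𝓡 m) (fun p : G × M => p.1 • p.2) (1, x) (ξ, 0) := by
    refine Eq.trans ?_ (mfderiv_prod_eq_add_apply (hsmul.mdifferentiable (by simp) _)).symm
    refine (infinitesimalGenerator_eq_mfderiv ξ x).trans ?_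
    have aux (a b : EuclideanSpace ℝ (Fin m)) (hb : b = 0) : a = a + b := by rw [hb, add_zero]
    exact aux _ _ (map_zero _)
  have key (x' : M) (hx : x = x') (v v' : EuclideanSpace ℝ (Fin m)) (hv : v = v') :
      (⟨x, v⟩ : TangentBundle (𝓡 m) M) = ⟨x', v'⟩ := by
    subst hx hv
    rfl
  exact key _ (one_smul G x).symm _ _ hv

theorem mfderiv_apply_infinitesimalGenerator_eq_zero [T2Space G]
    {H : M → ℝ} (hH : MDifferentiable (𝓡 m) 𝓘(ℝ, ℝ) H) (hinv : ∀ (g : G) (x : M), H (g • x) = H x)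
    (ξ : GroupLieAlgebra (𝓡 k) G) (x : M) :
    mfderiv (𝓡 m) 𝓘(ℝ, ℝ) H x (infinitesimalGenerator ξ x) = 0 := by
  have h1 := mfderiv_comp (1 : G) (hH ((1 : G) • x)) (mdifferentiableAt_smul_const (k := k) x 1)
  have h2 : H ∘ (fun g : G => g • x) = fun _ => H x := funext fun g => hinv g x
  rw [h2, mfderiv_const] at h1
  have h3 := congrArg (fun A : EuclideanSpace ℝ (Fin k) →L[ℝ] ℝ => A ξ) h1
  have h4 (x' : M) (hx : x = x') (v v' : EuclideanSpace ℝ (Fin m)) (hv : v = v') :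
      (mfderiv (𝓡 m) 𝓘(ℝ, ℝ) H x : EuclideanSpace ℝ (Fin m) →L[ℝ] ℝ) v =
        (mfderiv (𝓡 m) 𝓘(ℝ, ℝ) H x' : EuclideanSpace ℝ (Fin m) →L[ℝ] ℝ) v' := by
    subst hx hv
    rfl
  exact (h4 _ (one_smul G x).symm _ _ (infinitesimalGenerator_eq_mfderiv ξ x)).trans h3.symm

/-! ### The action in a chart -/

variable [IsManifold (𝓡 m) ∞ M]

theorem contDiffAt_actionInChart {x₀ : M} {p : EuclideanSpace ℝ (Fin k)}
    {y : EuclideanSpace ℝ (Fin m)} (hp : p ∈ (extChartAt (𝓡 k) (1 : G)).target)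
    (hy : y ∈ (extChartAt (𝓡 m) x₀).target)
    (h : (extChartAt (𝓡 k) (1 : G)).symm p • (extChartAt (𝓡 m) x₀).symm y ∈
      (extChartAt (𝓡 m) x₀).source) :
    ContDiffAt ℝ ∞ (actionInChart G x₀) (p, y) := by
  rw [← contMDiffAt_iff_contDiffAt]
  have h1 : ContMDiffAt 𝓘(ℝ, EuclideanSpace ℝ (Fin k) × EuclideanSpace ℝ (Fin m))
      (𝓡 k) ∞ (fun q : EuclideanSpace ℝ (Fin k) × EuclideanSpace ℝ (Fin m) =>
        (extChartAt (𝓡 k) (1 : G)).symm q.1) (p, y) :=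
    (contMDiffAt_extChartAt_symm_of_mem hp).comp (p, y) contDiffAt_fst.contMDiffAt
  have h2 : ContMDiffAt 𝓘(ℝ, EuclideanSpace ℝ (Fin k) × EuclideanSpace ℝ (Fin m))
      (𝓡 m) ∞ (fun q : EuclideanSpace ℝ (Fin k) × EuclideanSpace ℝ (Fin m) =>
        (extChartAt (𝓡 m) x₀).symm q.2) (p, y) :=
    (contMDiffAt_extChartAt_symm_of_mem hy).comp (p, y) contDiffAt_snd.contMDiffAt
  exact (contMDiffAt_extChartAt_of_mem h).comp (p, y)
    ((contMDiff_smul (I := 𝓡 k) (I' := 𝓡 m) (n := ∞) (G := G) (M := M)).contMDiffAt.comp (p, y)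
      (h1.prodMk h2))

theorem contDiffAt_actionInChart_self {x₀ : M} {y : EuclideanSpace ℝ (Fin m)}
    (hy : y ∈ (extChartAt (𝓡 m) x₀).target) :
    ContDiffAt ℝ ∞ (actionInChart G x₀) (extChartAt (𝓡 k) (1 : G) 1, y) := by
  refine contDiffAt_actionInChart (mem_extChartAt_target _) hy ?_
  rw [smul_extChartAt_symm_self]
  exact (extChartAt (𝓡 m) x₀).map_target hy

theorem fieldInChart_infinitesimalGenerator [T2Space G] (ξ : GroupLieAlgebra (𝓡 k) G) {x₀ : M}
    {y : EuclideanSpace ℝ (Fin m)} (hy : y ∈ (extChartAt (𝓡 m) x₀).target) :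
    fieldInChart (fun x => infinitesimalGenerator ξ x) x₀ y =
      fderiv ℝ (actionInChart G x₀) (extChartAt (𝓡 k) (1 : G) 1, y)
        ((ξ : EuclideanSpace ℝ (Fin k)), 0) := by
  set x := (extChartAt (𝓡 m) x₀).symm y with hx
  set p := extChartAt (𝓡 k) (1 : G) 1 with hp
  have hsrc : x ∈ (extChartAt (𝓡 m) x₀).source := (extChartAt (𝓡 m) x₀).map_target hy
  have hF : HasFDerivAt (actionInChart G x₀) (fderiv ℝ (actionInChart G x₀) (p, y)) (p, y) :=
    ((contDiffAt_actionInChart_self (k := k) (G := G) hy).differentiableAt (by simp)).hasFDerivAt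
  have hl : HasFDerivAt (fun q : EuclideanSpace ℝ (Fin k) => (q, y))
      (ContinuousLinearMap.inl ℝ (EuclideanSpace ℝ (Fin k)) (EuclideanSpace ℝ (Fin m))) p :=
    hasFDerivAt_prodMk_left p y
  have h1 := hF.comp p hl
  -- the same partial derivative, computed factor by factor
  have hψ := ((contMDiffAt_extChartAt_symm_of_mem (mem_extChartAt_target
    (I := 𝓡 k) (1 : G))).mdifferentiableAt (by simp)).hasMFDerivAt
  have hψ1 : (extChartAt (𝓡 k) (1 : G)).symm p = 1 := extChartAt_to_inv (I := 𝓡 k) (1 : G)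
  have key (g : G) (hg : g = 1) : HasMFDerivAt (𝓡 k) 𝓘(ℝ, EuclideanSpace ℝ (Fin m))
      (fun g : G => extChartAt (𝓡 m) x₀ (g • x)) g
      ((chartDeriv x₀ x).comp (mfderiv (𝓡 k) (𝓡 m) (fun g : G => g • x) 1 :
        EuclideanSpace ℝ (Fin k) →L[ℝ] EuclideanSpace ℝ (Fin m))) := by
    subst hg
    have hφ (x' : M) (hx' : x' = x) : HasMFDerivAt (𝓡 m) 𝓘(ℝ, EuclideanSpace ℝ (Fin m))
        (extChartAt (𝓡 m) x₀) x' (chartDeriv x₀ x) := by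
      subst hx'
      exact ((contMDiffAt_extChartAt_of_mem hsrc).mdifferentiableAt (by simp)).hasMFDerivAt
    exact (hφ _ (one_smul G x)).comp 1 (mdifferentiableAt_smul_const (k := k) x 1).hasMFDerivAt
  have h2 := ((key _ hψ1).comp p hψ).hasFDerivAt
  have h3 := DFunLike.congr_fun (h1.unique h2) ξ
  have h4 : chartSymmDeriv (1 : G) p ξ = ξ := by
    rw [hp, chartSymmDeriv_self]
    rfl
  refine Eq.trans ?_ h3.symm
  refine congrArg (chartDeriv x₀ x) ?_
  refine (infinitesimalGenerator_eq_mfderiv ξ x).trans ?_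
  exact congrArg (mfderiv (𝓡 k) (𝓡 m) (fun g : G => g • x) 1 :
    EuclideanSpace ℝ (Fin k) →L[ℝ] EuclideanSpace ℝ (Fin m)) h4.symm

/-- The partial pullback of an invariant form along the action in a chart is the form itself. -/
theorem form_actionInChart {β : (x : M) → TangentSpace (𝓡 m) x →L[ℝ] ℝ}
    (hβ : ∀ (g : G) (x : M) (v : TangentSpace (𝓡 m) x),
      β (g • x) (mfderiv (𝓡 m) (𝓡 m) (fun x : M => g • x) x v) = β x v)
    {x₀ : M} {p : EuclideanSpace ℝ (Fin k)} {y : EuclideanSpace ℝ (Fin m)}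
    (hp : p ∈ (extChartAt (𝓡 k) (1 : G)).target)
    (hy : y ∈ (extChartAt (𝓡 m) x₀).target)
    (h : (extChartAt (𝓡 k) (1 : G)).symm p • (extChartAt (𝓡 m) x₀).symm y ∈
      (extChartAt (𝓡 m) x₀).source) (v : EuclideanSpace ℝ (Fin m)) :
    formInChart β x₀ (actionInChart G x₀ (p, y)) (fderiv ℝ (actionInChart G x₀) (p, y) (0, v)) =
      formInChart β x₀ y v := by
  set x := (extChartAt (𝓡 m) x₀).symm y with hx
  set g := (extChartAt (𝓡 k) (1 : G)).symm p with hg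
  have hF : HasFDerivAt (actionInChart G x₀) (fderiv ℝ (actionInChart G x₀) (p, y)) (p, y) :=
    ((contDiffAt_actionInChart hp hy h).differentiableAt (by simp)).hasFDerivAt
  have hr : HasFDerivAt (fun z : EuclideanSpace ℝ (Fin m) => (p, z))
      (ContinuousLinearMap.inr ℝ (EuclideanSpace ℝ (Fin k)) (EuclideanSpace ℝ (Fin m))) y :=
    hasFDerivAt_prodMk_right p y
  have h1 := hF.comp y hr
  have hφ := ((contMDiffAt_extChartAt_symm_of_mem hy).mdifferentiableAt (by simp)).hasMFDerivAt
  have hΦ : HasMFDerivAt (𝓡 m) (𝓡 m) (fun x : M => g • x) x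
      (mfderiv (𝓡 m) (𝓡 m) (fun x : M => g • x) x) :=
    (((contMDiff_smul (I := 𝓡 k) (I' := 𝓡 m) (n := ∞) (G := G) (M := M)).comp
      (contMDiff_const.prodMk contMDiff_id)).contMDiffAt.mdifferentiableAt (by simp)).hasMFDerivAt
  have hψ := ((contMDiffAt_extChartAt_of_mem h).mdifferentiableAt (by simp)).hasMFDerivAt
  have h2 := (hψ.comp y (hΦ.comp y hφ)).hasFDerivAt
  have h3 := DFunLike.congr_fun (h1.unique h2) v
  have h4 : chartSymmDeriv x₀ (extChartAt (𝓡 m) x₀ (g • x)) (chartDeriv x₀ (g • x)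
      (mfderiv (𝓡 m) (𝓡 m) (fun x : M => g • x) x (chartSymmDeriv x₀ y v))) =
      mfderiv (𝓡 m) (𝓡 m) (fun x : M => g • x) x (chartSymmDeriv x₀ y v) := by
    have h5 := chartSymmDeriv_comp_chartDeriv ((extChartAt (𝓡 m) x₀).map_source h)
    rw [(extChartAt (𝓡 m) x₀).left_inv h] at h5
    exact DFunLike.congr_fun h5 _
  refine (congrArg (formInChart β x₀ (actionInChart G x₀ (p, y))) h3).trans ?_
  refine Eq.trans ?_ (hβ g x (chartSymmDeriv x₀ y v))
  exact form_congr β ((extChartAt (𝓡 m) x₀).left_inv h) h4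

/-! ### The Lie derivative of an invariant form along a generator -/

variable [T2Space G]

theorem eventuallyEq_fieldInChart_infinitesimalGenerator (ξ : GroupLieAlgebra (𝓡 k) G) (x₀ : M) :
    fieldInChart (fun x => infinitesimalGenerator ξ x) x₀ =ᶠ[𝓝 (extChartAt (𝓡 m) x₀ x₀)]
      fun y => fderiv ℝ (actionInChart G x₀) (extChartAt (𝓡 k) (1 : G) 1, y)
        ((ξ : EuclideanSpace ℝ (Fin k)), 0) := by
  filter_upwards [extChartAt_target_mem_nhds (I := 𝓡 m) x₀] with y hy
  exact fieldInChart_infinitesimalGenerator ξ hy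

theorem differentiableAt_fieldInChart_infinitesimalGenerator (ξ : GroupLieAlgebra (𝓡 k) G)
    (x₀ : M) :
    DifferentiableAt ℝ (fieldInChart (fun x => infinitesimalGenerator ξ x) x₀)
      (extChartAt (𝓡 m) x₀ x₀) := by
  refine DifferentiableAt.congr_of_eventuallyEq ?_
    (eventuallyEq_fieldInChart_infinitesimalGenerator ξ x₀)
  set y := extChartAt (𝓡 m) x₀ x₀ with hy
  have hF : ContDiffAt ℝ 2 (actionInChart G x₀) (extChartAt (𝓡 k) (1 : G) 1, y) :=
    (contDiffAt_actionInChart_self (mem_extChartAt_target x₀)).of_le ENat.LEInfty.out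
  have h1 := (hF.fderiv_right (m := 1) (by norm_num)).differentiableAt (by simp)
  exact (h1.hasFDerivAt.comp y (hasFDerivAt_prodMk_right _ y)).differentiableAt.clm_apply
    (differentiableAt_const _)

/-- `L_{ξ_M} β = 0` for an invariant `1`-form `β`, read in the preferred chart at `x₀`. -/
theorem lieDeriv_formInChart_eq_zero {β : (x : M) → TangentSpace (𝓡 m) x →L[ℝ] ℝ} {x₀ : M}
    (hβs : DifferentiableAt ℝ (formInChart β x₀) (extChartAt (𝓡 m) x₀ x₀))
    (hβ : ∀ (g : G) (x : M) (v : TangentSpace (𝓡 m) x),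
      β (g • x) (mfderiv (𝓡 m) (𝓡 m) (fun x : M => g • x) x v) = β x v)
    (ξ : GroupLieAlgebra (𝓡 k) G) (v : EuclideanSpace ℝ (Fin m)) :
    fderiv ℝ (formInChart β x₀) (extChartAt (𝓡 m) x₀ x₀)
        (fieldInChart (fun x => infinitesimalGenerator ξ x) x₀ (extChartAt (𝓡 m) x₀ x₀)) v +
      formInChart β x₀ (extChartAt (𝓡 m) x₀ x₀)
        (fderiv ℝ (fieldInChart (fun x => infinitesimalGenerator ξ x) x₀)
          (extChartAt (𝓡 m) x₀ x₀) v) = 0 := by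
  set y := extChartAt (𝓡 m) x₀ x₀ with hy
  set p := extChartAt (𝓡 k) (1 : G) 1 with hp
  have hyt : y ∈ (extChartAt (𝓡 m) x₀).target := mem_extChartAt_target x₀
  have hpt : p ∈ (extChartAt (𝓡 k) (1 : G)).target := mem_extChartAt_target (1 : G)
  have hF : ContDiffAt ℝ 2 (actionInChart G x₀) (p, y) :=
    (contDiffAt_actionInChart_self hyt).of_le ENat.LEInfty.out
  have hFp : ∀ᶠ z in 𝓝 y, actionInChart G x₀ (p, z) = z := by
    filter_upwards [extChartAt_target_mem_nhds (I := 𝓡 m) x₀] with z hz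
    exact actionInChart_self hz
  have hsrc : ∀ᶠ q in 𝓝 p, (extChartAt (𝓡 k) (1 : G)).symm q • (extChartAt (𝓡 m) x₀).symm y ∈
      (extChartAt (𝓡 m) x₀).source := by
    have hc : ContinuousAt
        (fun q => (extChartAt (𝓡 k) (1 : G)).symm q • (extChartAt (𝓡 m) x₀).symm y) p :=
      ContinuousAt.comp (f := (extChartAt (𝓡 k) (1 : G)).symm)
        (g := fun g : G => g • (extChartAt (𝓡 m) x₀).symm y)
        (mdifferentiableAt_smul_const (k := k) (m := m) _ _).continuousAt
        (contMDiffAt_extChartAt_symm_of_mem hpt).continuousAt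
    refine hc.preimage_mem_nhds (extChartAt_source_mem_nhds' ?_)
    rw [smul_extChartAt_symm_self]
    exact (extChartAt (𝓡 m) x₀).map_target hyt
  have hinv : ∀ᶠ q in 𝓝 p, formInChart β x₀ (actionInChart G x₀ (q, y))
      (fderiv ℝ (actionInChart G x₀) (q, y) (0, v)) = formInChart β x₀ y v := by
    filter_upwards [hsrc, extChartAt_target_mem_nhds (I := 𝓡 k) (1 : G)] with q hq hqt
    exact form_actionInChart hβ hqt hyt hq v
  have h := lieDeriv_form_eq_zero hF hFp hβs hinv (ξ : EuclideanSpace ℝ (Fin k))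
  rw [(eventuallyEq_fieldInChart_infinitesimalGenerator ξ x₀).fderiv_eq,
    (eventuallyEq_fieldInChart_infinitesimalGenerator ξ x₀).self_of_nhds]
  exact h

end Action

/-! ### The momentum map -/

section Momentum
variable {n k : ℕ} {G : Type*} [TopologicalSpace G] [ChartedSpace (EuclideanSpace ℝ (Fin k)) G]
  [Group G] [LieGroup (𝓡 k) ∞ G] [T2Space G]
  {M : Type*} [TopologicalSpace M] [ChartedSpace (EuclideanSpace ℝ (Fin (2 * n + 1))) M]
  [IsManifold (𝓡 (2 * n + 1)) ∞ M] [MulAction G M] [ContMDiffSMul (𝓡 k) (𝓡 (2 * n + 1)) ∞ G M]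

theorem contMDiff_momentumComponent (η : ContactForm n M) (ξ : GroupLieAlgebra (𝓡 k) G) :
    ContMDiff (𝓡 (2 * n + 1)) 𝓘(ℝ, ℝ) ∞ (momentumComponent η ξ) := by
  have h := η.contMDiff_form.clm_bundle_apply (v := fun x => infinitesimalGenerator ξ x)
    (contMDiff_infinitesimalGenerator (M := M) ξ)
  have h1 : ContMDiff (𝓡 (2 * n + 1)) 𝓘(ℝ, ℝ) ∞
      (fun x => η.form x (infinitesimalGenerator ξ x)) := fun x =>
    ((Bundle.contMDiffAt_totalSpace (F := ℝ) (E := Bundle.Trivial M ℝ)).1 (h x)).2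
  exact h1.neg

/-- `dĴ(ξ) = ι_{ξ_M} dη`: Cartan's formula `L_X η = d(η(X)) + ι_X dη` with `L_X η = 0`. -/
theorem differential_momentumComponent (η : ContactForm n M)
    (hη : ∀ g : G, η.IsPreservedBy (fun x : M => g • x)) (ξ : GroupLieAlgebra (𝓡 k) G) (x₀ : M) :
    differential (momentumComponent η ξ) x₀ = contract (η.d x₀) (infinitesimalGenerator ξ x₀) := by
  refine LinearMap.ext fun (v : EuclideanSpace ℝ (Fin (2 * n + 1))) => ?_
  set y := extChartAt (𝓡 (2 * n + 1)) x₀ x₀ with hy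
  have hα : DifferentiableAt ℝ (formInChart η.form x₀) y :=
    (contDiffAt_formInChart (η.contMDiff_form x₀)).differentiableAt (by simp)
  have hX := differentiableAt_fieldInChart_infinitesimalGenerator (m := 2 * n + 1) ξ x₀
  have hL := lieDeriv_formInChart_eq_zero hα hη ξ v
  have hX₀ := fieldInChart_self (m := 2 * n + 1) (fun x => infinitesimalGenerator ξ x) x₀
  have h1 : fderiv ℝ (momentumComponent η ξ ∘ (extChartAt (𝓡 (2 * n + 1)) x₀).symm) y v =
      differential (momentumComponent η ξ) x₀ v := by
    refine (fderiv_comp_extChartAt_symm ((contMDiff_momentumComponent η ξ).mdifferentiable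
      (by simp)) (mem_extChartAt_target x₀) v).trans ?_
    have key (x' : M) (hx : x' = x₀) (v' : EuclideanSpace ℝ (Fin (2 * n + 1))) (hv : v' = v) :
        differential (momentumComponent η ξ) x' v' = differential (momentumComponent η ξ) x₀ v := by
      subst hx hv
      rfl
    refine key _ (extChartAt_to_inv x₀) _ ?_
    rw [chartSymmDeriv_self]
    rfl
  have h2 : momentumComponent η ξ ∘ (extChartAt (𝓡 (2 * n + 1)) x₀).symm =ᶠ[𝓝 y]
      fun z => -(formInChart η.form x₀ z
        (fieldInChart (fun x => infinitesimalGenerator ξ x) x₀ z)) := by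
    filter_upwards [extChartAt_target_mem_nhds (I := 𝓡 (2 * n + 1)) x₀] with z hz
    rw [formInChart_fieldInChart _ _ hz]
    rfl
  have h3 : contract (η.d x₀) (infinitesimalGenerator ξ x₀) v =
      fderiv ℝ (formInChart η.form x₀) y
        (fieldInChart (fun x => infinitesimalGenerator ξ x) x₀ y) v -
      fderiv ℝ (formInChart η.form x₀) y v
        (fieldInChart (fun x => infinitesimalGenerator ξ x) x₀ y) := by
    refine (contract_apply _ _ _).trans ((dOneForm_eq_extDeriv η.form x₀ _).trans
      ((extDeriv_ofSubsingleton_apply hα _ _).trans ?_))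
    exact congrArg (fun w : EuclideanSpace ℝ (Fin (2 * n + 1)) =>
      fderiv ℝ (formInChart η.form x₀) y w v - fderiv ℝ (formInChart η.form x₀) y v w) hX₀.symm
  refine h1.symm.trans (Eq.trans ?_ h3.symm)
  rw [h2.fderiv_eq, fderiv_fun_neg, _root_.neg_apply, fderiv_form_apply_field hα hX]
  linarith

/-- In a chart at `x₀`, write `X` for `ξ_M`, `Y` for `X_H` and `α` for `η`. Invariance of `η` gives
`Dα(X) Y + α(DX Y) = 0`, and `α(Y) = -H` with `X(H) = 0` gives `Dα(X) Y + α(DY X) = 0`. The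
difference is `α(DX Y - DY X) = η([X_H, ξ_M])`. -/
theorem form_mlieBracket_hamiltonianField (η : ContactForm n M) {H : M → ℝ}
    (hH : ContMDiff (𝓡 (2 * n + 1)) 𝓘(ℝ, ℝ) ∞ H)
    (hη : ∀ g : G, η.IsPreservedBy (fun x : M => g • x))
    (hinv : ∀ (g : G) (x : M), H (g • x) = H x) (ξ : GroupLieAlgebra (𝓡 k) G) (x₀ : M) :
    η.form x₀ (VectorField.mlieBracket (𝓡 (2 * n + 1)) (η.hamiltonianField H)
      (fun x => infinitesimalGenerator ξ x) x₀) = 0 := by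
  set y := extChartAt (𝓡 (2 * n + 1)) x₀ x₀ with hy
  have hα : DifferentiableAt ℝ (formInChart η.form x₀) y :=
    (contDiffAt_formInChart (η.contMDiff_form x₀)).differentiableAt (by simp)
  set X := fieldInChart (m := 2 * n + 1) (fun x => infinitesimalGenerator ξ x) x₀ with hX
  set Y := fieldInChart (η.hamiltonianField H) x₀ with hY
  have hL : fderiv ℝ (formInChart η.form x₀) y (X y) (Y y) +
      formInChart η.form x₀ y (fderiv ℝ X y (Y y)) = 0 :=
    lieDeriv_formInChart_eq_zero hα hη ξ _
  have hYd : DifferentiableAt ℝ Y y := η.differentiableAt_hamiltonianField hH x₀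
  have h1 : (fun z => formInChart η.form x₀ z (Y z)) =ᶠ[𝓝 y]
      fun z => -((H ∘ (extChartAt (𝓡 (2 * n + 1)) x₀).symm) z) := by
    filter_upwards [extChartAt_target_mem_nhds (I := 𝓡 (2 * n + 1)) x₀] with z hz
    rw [hY, formInChart_fieldInChart _ _ hz, ContactForm.form_hamiltonianField]
    rfl
  have hd := hH.mdifferentiable (by simp)
  have h2 : fderiv ℝ (fun z => formInChart η.form x₀ z (Y z)) y (X y) = 0 := by
    rw [h1.fderiv_eq, fderiv_fun_neg, _root_.neg_apply, neg_eq_zero]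
    refine (fderiv_comp_extChartAt_symm hd (mem_extChartAt_target x₀) _).trans ?_
    refine (congrArg _ (chartSymmDeriv_fieldInChart _ (mem_extChartAt_target x₀))).trans ?_
    exact mfderiv_apply_infinitesimalGenerator_eq_zero hd hinv ξ _
  rw [fderiv_form_apply_field hα hYd] at h2
  rw [mlieBracket_eq_lieBracket_fieldInChart]
  have h3 : formInChart η.form x₀ y (VectorField.lieBracket ℝ Y X y) = 0 := by
    rw [VectorField.lieBracket, map_sub]
    linarith
  rw [formInChart_self] at h3
  exact h3

end Momentum

end
end ContactGeometry

open ContactGeometry in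
theorem mainTheorem7 (n k : ℕ)
    {M : Type*} [TopologicalSpace M] [T2Space M]
    [ChartedSpace (EuclideanSpace ℝ (Fin (2 * n + 1))) M] [IsManifold (𝓡 (2 * n + 1)) ∞ M]
    (η : ContactForm n M) (H : M → ℝ) (hH : ContMDiff (𝓡 (2 * n + 1)) 𝓘(ℝ, ℝ) ∞ H)
    {G : Type*} [TopologicalSpace G] [T2Space G]
    [ChartedSpace (EuclideanSpace ℝ (Fin k)) G] [Group G] [LieGroup (𝓡 k) ∞ G]
    [MulAction G M] [ContMDiffSMul (𝓡 k) (𝓡 (2 * n + 1)) ∞ G M]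
    (hη : ∀ g : G, η.IsPreservedBy (fun x : M => g • x))
    (hinv : ∀ (g : G) (x : M), H (g • x) = H x)
    (ξ : GroupLieAlgebra (𝓡 k) G) :
    IsDynamicalSymmetry η H (fun x => infinitesimalGenerator ξ x) ∧
      IsDissipated η H (momentumComponent η ξ) :=
  ⟨⟨contMDiff_infinitesimalGenerator ξ, form_mlieBracket_hamiltonianField η hH hη hinv ξ⟩,
    contMDiff_momentumComponent η ξ, fun x => η.jacobiBracket_eq_zero rfl
      (differential_momentumComponent η hη ξ x)
      (mfderiv_apply_infinitesimalGenerator_eq_zero (hH.mdifferentiable (by simp)) hinv ξ x)⟩
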